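/- A set $S\subset\mathbb{R}^3$ is \emph{antipodal} if for any two distinct $x,y\in S$ there are two distinct parallel planes, one through $x$ and one through $y$, such that $S$ is contained in the closed slab bounded by them. Two polytopes are \emph{combinatorially equivalent} if their face lattices are isomorphic. We write $[pq]=\operatorname{conv}\{p,q\}$. \textbf{Theorem.} Let $S$ be an antipodal set of exactly $6$ points in $\mathbb{R}^3$. Then there exist two distinct parallel planes $\Pi_1,\Pi_2$ with $|S\cap\Pi_1|=|S\cap\Pi_2|=3$; moreover, writing $S\cap\Pi_1=\{a_1,a_2,a_3\}$ and $S\cap\Pi_2=\{b_1,b_2,b_3\}$, none of the $12$ (not necessarily distinct) points $a_i-a_j$, $b_i-b_j$ $(i\ne j)$ is in the relative interior of the convex hull of the remaining $11$. Furthermore, $\operatorname{conv} S$ is of one of the following two types: (1) $\operatorname{conv} S$ is combinatorially equivalent to an octahedron, and some two opposite (that is, disjoint) facets of it are parallel; (2) $\operatorname{conv} S$ is a ``skew'' triangular prism: the points of $S$ can be labelled $a,b,c,d,e,f$ such that $abcd$ is a (nondegenerate) parallelogram with $b-a=c-d$, $\operatorname{conv}\{a,b,c,d\}$ is a facet of $\operatorname{conv}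 S$, and $[ef]$ is an edge of $\operatorname{conv} S$ that is a translate of some segment $[e'f']$ with $e'\in[ad]$ and $f'\in[bc]$, where $e$ corresponds to $e'$ and $f$ to $f'$; hence the planes $ade$ and $bcf$ are parallel. If the line $ef$ is parallel to the line $ab$, then $\operatorname{conv} S$ is combinatorially equivalent to the triangular prism $$\operatorname{conv}\{(0,0,0),(1,0,0),(1,1,0),(0,1,0),(0,0,1),(1,0,1)\},$$ and otherwise it is combinatorially equivalent to $$\operatorname{conv}\{(0,0,0),(1,0,0),(1,1,0),(0,1,0),(0,0,1),(1,1,1)\}.$$ The octahedron $\operatorname{conv}\{(\pm1,0,0),(0,\pm1,0),(0,0,\pm1)\}$ and the two polytopes just displayed are pairwise not combinatorially equivalent, and each of them is the convex hull of an antipodal set of $6$ points, namely the set of points listed. -/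

import Mathlib

open scoped Affine

/-- Three-dimensional real space. -/
abbrev Space3 : Type := EuclideanSpace ℝ (Fin 3)

/-- `S` is antipodal: any two distinct points `x`, `y` of `S` lie on two distinct parallel
hyperplanes `{f = f x}` and `{f = f y}` such that `S` is contained in the closed slab
`{f x ≤ f ≤ f y}` bounded by them (`f x < f y` makes `f` nonzero). -/
def IsAntipodal (S : Set Space3) : Prop :=
  ∀ x ∈ S, ∀ y ∈ S, x ≠ y →
    ∃ f : Space3 →L[ℝ] ℝ, f x < f y ∧ ∀ s ∈ S, f x ≤ f s ∧ f s ≤ f y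

/-- The affine subspace is two-dimensional. -/
def IsPlane (H : AffineSubspace ℝ Space3) : Prop :=
  Module.finrank ℝ H.direction = 2

/-- `F` is a face of the polytope `P`: it is empty, or it is the set of maximizers on `P` of some
linear functional (the zero functional gives `P` itself). -/
def IsFace (P F : Set Space3) : Prop := IsExposed ℝ P F

/-- `F` is a facet of `P`: a face of dimension `dim P - 1`. -/
def IsFacet (P F : Set Space3) : Prop :=
  IsFace P F ∧ Module.finrank ℝ (vectorSpan ℝ F) + 1 = Module.finrank ℝ (vectorSpan ℝ P)

/-- `F` is an edge of `P`: a face of dimension one. -/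
def IsEdge (P F : Set Space3) : Prop :=
  IsFace P F ∧ Module.finrank ℝ (vectorSpan ℝ F) = 1

/-- Two polytopes are combinatorially equivalent if their face lattices (all faces, including
the empty face and the polytope itself, ordered by inclusion) are isomorphic. -/
def CombinatoriallyEquivalent (P Q : Set Space3) : Prop :=
  Nonempty ({F : Set Space3 // IsFace P F} ≃o {G : Set Space3 // IsFace Q G})

/-- The vertices `±e₁, ±e₂, ±e₃` of the regular octahedron. -/
def octahedronVertices : Set Space3 :=
  {!₂[1, 0, 0], !₂[-1, 0, 0], !₂[0, 1, 0], !₂[0, -1, 0], !₂[0, 0, 1], !₂[0, 0, -1]}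

/-- The vertices of a triangular prism: two parallel triangles that are translates of each other
by `(1, 0, 0)`. -/
def prismVertices : Set Space3 :=
  {!₂[0, 0, 0], !₂[1, 0, 0], !₂[1, 1, 0], !₂[0, 1, 0], !₂[0, 0, 1], !₂[1, 0, 1]}

/-- The vertices of a skew prism whose top edge, from `(0, 0, 1)` to `(1, 1, 1)`, is not parallel
to a side of its square facet. -/
def skewPrismVertices : Set Space3 :=
  {!₂[0, 0, 0], !₂[1, 0, 0], !₂[1, 1, 0], !₂[0, 1, 0], !₂[0, 0, 1], !₂[1, 1, 1]}

/-- `a, b, c, d` are, in this cyclic order, the vertices of a nondegenerate parallelogram. -/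
def IsParallelogram (a b c d : Space3) : Prop :=
  b - a = c - d ∧ AffineIndependent ℝ ![a, b, d]

/-- For two triples of points, none of the twelve (not necessarily distinct) differences of two
different points of the same triple lies in the relative interior of the convex hull of the eleven
remaining ones. The differences are indexed by ordered pairs, so that removing one of them keeps
another one that happens to be equal to it. -/
def DifferencesOnBoundary (T₁ T₂ : Set Space3) : Prop :=
  ∀ p ∈ T₁.offDiag ∪ T₂.offDiag,
    p.1 - p.2 ∉ intrinsicInterior ℝ (convexHull ℝ
      ((fun q : Space3 × Space3 => q.1 - q.2) '' ((T₁.offDiag ∪ T₂.offDiag) \ {p})))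

/-- The convex hull of `S` is an octahedron, up to combinatorial equivalence, and some two of its
opposite facets are parallel. Facets of an octahedron are opposite when they are disjoint. -/
def IsOctahedralType (S : Set Space3) : Prop :=
  CombinatoriallyEquivalent (convexHull ℝ S) (convexHull ℝ octahedronVertices) ∧
  ∃ F G : Set Space3, IsFacet (convexHull ℝ S) F ∧ IsFacet (convexHull ℝ S) G ∧
    Disjoint F G ∧ affineSpan ℝ F ∥ affineSpan ℝ G

/-- The convex hull of `S` is a "skew" triangular prism: `S = {a, b, c, d, e, f}`, where
the parallelogram `abcd` is a facet, and the edge `[ef]` is a translate of a segment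
`[e'f']` with `e' ∈ [ad]` and `f' ∈ [bc]`, so that `ade` and `bcf` are parallel planes. Its
combinatorial type depends on whether `ef` is parallel to `ab`. -/
def IsSkewPrismType (S : Set Space3) : Prop :=
  ∃ a b c d e f : Space3,
    S = {a, b, c, d, e, f} ∧
    IsParallelogram a b c d ∧
    IsFacet (convexHull ℝ S) (convexHull ℝ {a, b, c, d}) ∧
    IsEdge (convexHull ℝ S) (segment ℝ e f) ∧
    (∃ e' ∈ segment ℝ a d, ∃ f' ∈ segment ℝ b c, ∃ t : Space3, e = t + e' ∧ f = t + f') ∧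
    IsPlane (affineSpan ℝ {a, d, e}) ∧ IsPlane (affineSpan ℝ {b, c, f}) ∧
    affineSpan ℝ {a, d, e} ∥ affineSpan ℝ {b, c, f} ∧
    (line[ℝ, e, f] ∥ line[ℝ, a, b] →
      CombinatoriallyEquivalent (convexHull ℝ S) (convexHull ℝ prismVertices)) ∧
    (¬ line[ℝ, e, f] ∥ line[ℝ, a, b] →
      CombinatoriallyEquivalent (convexHull ℝ S) (convexHull ℝ skewPrismVertices))

/-! Let `s 0, …, s 5` be the points and `φ` an affine dependence, so `∑ φ k = 0` and `∑ φ k • s k =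
0`. For `i ≠ j` antipodality gives an affine function with value `-1` at `s i`, `1` at `s j` and
absolute value at most `1` at all points. Pairing it with `φ` bounds `|φ i - φ j|` by the sum of the
other `|φ k|`. Everything else follows from these inequalities (`AntipodalVector`).

The dependences form a space of dimension at least `6 - 4 = 2`, and the inequalities allow no more
(`finrank_le_two_of_antipodalVector`). A basis `p, q` gives the Gale diagram, six plane vectors `g k
= (p k, q k)`. The `i`-th row of the determinants `bracket p q i j` is again a dependence, so it
obeys the inequalities too. Each row needs two positive and two negative entries. A finite check of
the cyclic orders of the lines `ℝ g k`, with a side of the origin for each vector, then leaves two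
weak sign patterns: those of the octahedron and of the other simplicial polytope with six vertices
(`IsBalanced.exists_shift`).

In the octahedral pattern the row inequalities close up to a cycle and become equalities, giving `g
0 + g 2 + g 4 = 0`; so some affine function is `1` on one triple and `0` on the other. If a bracket
of opposite vectors vanishes, the polytope is a skew prism, otherwise an octahedron. In the other
pattern a Plücker relation forces two opposite vectors, and again a skew prism results.

Faces are read off from index sets. A nonnegative vector orthogonal to all dependences is a list of
distances from a supporting plane, which produces facets; the signs of dependences rule out all
index sets that are not intersections of these facets. The three types have 28, 22 and 26 faces, so
they are inequivalent. The statement on differences is separate: the separating functional of two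
points attains its minimum over all differences at their difference
(`IsAntipodal.differencesOnBoundary`). -/

/-! ### Inequalities for affine dependences -/

/-- The inequalities satisfied by the affine dependences of an antipodal set of six points. -/
def AntipodalVector (φ : Fin 6 → ℝ) : Prop :=
  ∑ k, φ k = 0 ∧ ∀ i j, i ≠ j → |φ i - φ j| + |φ i| + |φ j| ≤ ∑ k, |φ k|

theorem AntipodalVector.comp {φ : Fin 6 → ℝ} (h : AntipodalVector φ) (σ : Equiv.Perm (Fin 6)) :
    AntipodalVector (φ ∘ σ) := by
  refine ⟨?_, fun i j hij => ?_⟩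
  · simpa using (Equiv.sum_comp σ φ).trans h.1
  · have := h.2 (σ i) (σ j) (by simpa using hij)
    simpa using this.trans (Equiv.sum_comp σ fun k => |φ k|).ge

theorem AntipodalVector.neg {φ : Fin 6 → ℝ} (h : AntipodalVector φ) :
    AntipodalVector (fun k => -φ k) := by
  refine ⟨by simp [h.1], fun i j hij => ?_⟩
  have := h.2 i j hij
  simp only [abs_neg]
  rwa [show -φ i - -φ j = -(φ i - φ j) by ring, abs_neg]

/-- A nonzero antipodal vector has at least two positive entries. -/
theorem AntipodalVector.exists_pos {φ : Fin 6 → ℝ} (h : AntipodalVector φ) (hne : ∃ k, φ k ≠ 0)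
    (j : Fin 6) : ∃ k, k ≠ j ∧ 0 < φ k := by
  by_contra! hc
  -- The entries sum to zero, so adding them to the absolute values changes nothing, and every
  -- nonpositive entry then cancels.
  have habs : ∑ k, |φ k| = φ j + |φ j| := by
    have h1 : ∑ k, (|φ k| + φ k) = |φ j| + φ j :=
      Finset.sum_eq_single j (fun k _ hk => by rw [abs_of_nonpos (hc k hk)]; ring) (by simp)
    rw [Finset.sum_add_distrib, h.1] at h1
    linarith
  have hz : ∀ i, i ≠ j → φ i = 0 := by
    intro i hi
    have h1 := h.2 j i hi.symm
    have h2 := hc i hi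
    rw [habs, abs_of_nonpos h2] at h1
    have h3 := le_abs_self (φ j - φ i)
    linarith
  have hj : φ j = 0 := by
    rw [← h.1]
    exact (Finset.sum_eq_single j (fun k _ hk => hz k hk) (by simp)).symm
  obtain ⟨k, hk⟩ := hne
  by_cases hkj : k = j
  · exact hk (hkj ▸ hj)
  · exact hk (hz k hkj)

/-- If at most two entries of an antipodal vector are positive, then each of them dominates all
the negative ones. -/
theorem AntipodalVector.neg_le {φ : Fin 6 → ℝ} (h : AntipodalVector φ) {j l : Fin 6} (hjl : j ≠ l)
    (hj : 0 ≤ φ j) (hl : 0 ≤ φ l) (hneg : ∀ k, k ≠ j → k ≠ l → φ k ≤ 0) {k : Fin 6}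
    (hkj : k ≠ j) (hkl : k ≠ l) : -φ k ≤ φ j ∧ -φ k ≤ φ l := by
  have habs : ∑ k, |φ k| = 2 * φ j + 2 * φ l := by
    have h1 : ∑ k, (|φ k| + φ k) = (|φ j| + φ j) + (|φ l| + φ l) :=
      Finset.sum_eq_add j l hjl
        (fun k _ hk => by rw [abs_of_nonpos (hneg k hk.1 hk.2)]; ring) (by simp) (by simp)
    rw [Finset.sum_add_distrib, h.1, abs_of_nonneg hj, abs_of_nonneg hl] at h1
    linarith
  have h1 := h.2 j k hkj.symm
  have h2 := h.2 l k hkl.symm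
  have h3 := hneg k hkj hkl
  rw [habs, abs_of_nonpos h3] at h1 h2
  have h4 := le_abs_self (φ j - φ k)
  have h5 := le_abs_self (φ l - φ k)
  have h6 := le_abs_self (φ j)
  have h7 := le_abs_self (φ l)
  constructor <;> linarith

/-! ### Gale diagrams and recognition of skew prisms -/

/-- The determinant of the plane vectors `(p i, q i)` and `(p j, q j)`. -/
def bracket (p q : Fin 6 → ℝ) (i j : Fin 6) : ℝ := p i * q j - p j * q i

/-- The vectors `(p i, q i)` form a Gale diagram of an antipodal set of six points. -/
structure IsGale (p q : Fin 6 → ℝ) : Prop where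
  antipodal : ∀ x y : ℝ, AntipodalVector fun k => x * p k + y * q k
  exists_ne : ∀ i, ∃ j, bracket p q i j ≠ 0

theorem IsGale.comp {p q : Fin 6 → ℝ} (h : IsGale p q) (σ : Equiv.Perm (Fin 6)) :
    IsGale (p ∘ σ) (q ∘ σ) := by
  refine ⟨fun x y => (h.antipodal x y).comp σ, fun i => ?_⟩
  obtain ⟨j, hj⟩ := h.exists_ne (σ i)
  exact ⟨σ.symm j, by simpa [bracket] using hj⟩

/-- The row is the combination `-q i • p + p i • q`, the dependence of the pencil that vanishes at
`i`. -/
theorem IsGale.bracket_antipodal {p q : Fin 6 → ℝ} (h : IsGale p q) (i : Fin 6) :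
    AntipodalVector (bracket p q i) := by
  have := h.antipodal (-q i) (p i)
  convert this using 2 with k
  simp only [bracket]; ring

/-- The Gale diagram of an octahedron with two parallel facets. -/
structure IsOctahedralGale (p q : Fin 6 → ℝ) : Prop where
  sum_p : p 0 + p 2 + p 4 = 0
  sum_q : q 0 + q 2 + q 4 = 0
  h01 : 0 ≤ bracket p q 0 1
  h23 : 0 ≤ bracket p q 2 3
  h45 : 0 ≤ bracket p q 4 5
  h02 : 0 < bracket p q 0 2
  h03 : 0 < bracket p q 0 3
  h12 : 0 < bracket p q 1 2
  h13 : 0 < bracket p q 1 3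
  h24 : 0 < bracket p q 2 4
  h25 : 0 < bracket p q 2 5
  h34 : 0 < bracket p q 3 4
  h35 : 0 < bracket p q 3 5
  h40 : 0 < bracket p q 4 0
  h41 : 0 < bracket p q 4 1
  h50 : 0 < bracket p q 5 0
  h51 : 0 < bracket p q 5 1

/-- The affine dependence of a parallelogram. -/
def parallelogramDep : Fin 6 → ℝ := ![1, -1, 1, -1, 0, 0]

/-- The affine dependence of a skew prism that involves its top edge. -/
def topEdgeDep (α : ℝ) : Fin 6 → ℝ := ![1 - α, 0, -1, α, -1, 1]

/-- The span of `p` and `q` contains the two standard affine dependences of a skew prism. -/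
def IsPrismGale (p q : Fin 6 → ℝ) : Prop :=
  ∃ α : ℝ, 0 ≤ α ∧ α ≤ 1 ∧
    (∃ x y : ℝ, ∀ k, parallelogramDep k = x * p k + y * q k) ∧
    (∃ x y : ℝ, ∀ k, topEdgeDep α k = x * p k + y * q k)

/-- Up to relabelling, the Gale diagram is one of an octahedron or a skew prism. -/
def IsClassified (p q : Fin 6 → ℝ) : Prop :=
  ∃ σ : Equiv.Perm (Fin 6), IsOctahedralGale (p ∘ σ) (q ∘ σ) ∨ IsPrismGale (p ∘ σ) (q ∘ σ)

theorem IsClassified.of_comp {p q : Fin 6 → ℝ} (σ : Equiv.Perm (Fin 6))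
    (h : IsClassified (p ∘ σ) (q ∘ σ)) : IsClassified p q := by
  obtain ⟨τ, h⟩ := h
  exact ⟨τ.trans σ, h⟩

/-- A plane vector whose determinants with two independent vectors vanish is zero. This turns
equalities between brackets into vanishing sums of Gale vectors. -/
theorem eq_zero_of_bracket {a b c d x y : ℝ} (h : a * d - b * c ≠ 0)
    (h1 : a * y - x * c = 0) (h2 : b * y - x * d = 0) : x = 0 ∧ y = 0 := by
  constructor
  · have : x * (a * d - b * c) = 0 := by linear_combination b * h1 - a * h2
    exact (mul_eq_zero.1 this).resolve_right h
  · have : y * (a * d - b * c) = 0 := by linear_combination d * h1 - c * h2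
    exact (mul_eq_zero.1 this).resolve_right h

/-- Recognition of the Gale diagram of a skew prism. The labels `0, …, 5` stand for the
vertices `a, …, f`. -/
theorem isClassified_of_opposite {p q : Fin 6 → ℝ} (h : IsGale p q)
    (hp : p 4 + p 5 = 0) (hq : q 4 + q 5 = 0)
    (hp' : p 0 + p 3 + p 4 = 0) (hq' : q 0 + q 3 + q 4 = 0)
    (hpos : 0 < bracket p q 4 0) (heq : bracket p q 4 2 = bracket p q 4 0)
    (h0 : 0 ≤ bracket p q 2 0) (h2 : bracket p q 2 0 ≤ 2 * bracket p q 4 0) :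
    IsClassified p q := by
  have sp := (h.antipodal 1 0).1
  have sq := (h.antipodal 0 1).1
  simp only [Fin.sum_univ_six, one_mul, zero_mul, add_zero, zero_add] at sp sq
  set c := bracket p q 4 0 with hc
  -- For points with these dependences, row `0` divided by `c` says `f - e = (b - a) + (r - 1)(d -
  -- a)`. So `r - 1`, between `-1` and `1`, is the slope of the top edge relative to `ab`.
  set r := bracket p q 2 0 / c with hr
  have hcne : c ≠ 0 := hpos.ne'
  have hrc : bracket p q 2 0 = r * c := by rw [hr]; field_simp
  have hr0 : 0 ≤ r := by positivity
  have hr2 : r ≤ 2 := by rw [hr, div_le_iff₀ hpos]; linarith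
  have e5p : p 5 = -p 4 := by linarith
  have e5q : q 5 = -q 4 := by linarith
  have e3p : p 3 = -p 0 - p 4 := by linarith
  have e3q : q 3 = -q 0 - q 4 := by linarith
  have e1p : p 1 = p 4 - p 2 := by linarith
  have e1q : q 1 = q 4 - q 2 := by linarith
  simp only [bracket] at hc heq hrc
  have hQ : ∀ k, parallelogramDep k * c = -q 4 * p k + p 4 * q k := by
    intro k
    fin_cases k <;> simp [parallelogramDep, e5p, e5q, e3p, e3q, e1p, e1q] <;> linarith
  by_cases h1 : r ≤ 1
  -- The standard form wants `f' = c`, that is, a nonnegative slope. For `r ≤ 1` the reflection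
  -- exchanging `a, b`, then `c, d` and `e, f`, makes it so.
  · refine ⟨Equiv.ofBijective ![1, 0, 3, 2, 5, 4] (by decide), Or.inr ⟨r, hr0, h1, ?_, ?_⟩⟩
    · refine ⟨q 4 / c, -p 4 / c, fun k => ?_⟩
      have := hQ (![1, 0, 3, 2, 5, 4] k)
      field_simp
      fin_cases k <;> simp [parallelogramDep] at this ⊢ <;> linarith
    · refine ⟨q 0 / c, -p 0 / c, fun k => ?_⟩
      field_simp
      fin_cases k <;> simp [topEdgeDep, e5p, e5q, e3p, e3q, e1p, e1q] <;> linarith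
  · refine ⟨1, Or.inr ⟨2 - r, by linarith, by linarith, ?_, ?_⟩⟩
    · refine ⟨-q 4 / c, p 4 / c, fun k => ?_⟩
      have := hQ k
      field_simp
      simpa using this
    · refine ⟨-q 0 / c + (r - 1) * (-q 4 / c), p 0 / c + (r - 1) * (p 4 / c), fun k => ?_⟩
      have := hQ k
      have key : topEdgeDep (2 - r) k * c
          = -q 0 * p k + p 0 * q k + (r - 1) * (parallelogramDep k * c) := by
        fin_cases k <;>
          simp [parallelogramDep, topEdgeDep, e5p, e5q, e3p, e3q, e1p, e1q] <;> linarith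
      rw [this] at key
      field_simp
      simp only [Equiv.Perm.coe_one, Function.comp_apply, id]
      linarith

theorem forall_fin_six {P : Fin 6 → Prop} :
    (∀ k, P k) ↔ P 0 ∧ P 1 ∧ P 2 ∧ P 3 ∧ P 4 ∧ P 5 := by
  simp [Fin.forall_fin_succ]

theorem bracket_swap (p q : Fin 6 → ℝ) (i j : Fin 6) : bracket p q j i = -bracket p q i j := by
  simp only [bracket]; ring

theorem bracket_self (p q : Fin 6 → ℝ) (i : Fin 6) : bracket p q i i = 0 := by
  simp only [bracket]; ring

/-! ### Metric consequences of the two sign patterns -/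

/-- The signs of the brackets of a Gale diagram of an octahedron, up to degeneration. -/
structure IsWeakOctahedral (p q : Fin 6 → ℝ) : Prop where
  h01 : 0 ≤ bracket p q 0 1
  h02 : 0 ≤ bracket p q 0 2
  h03 : 0 ≤ bracket p q 0 3
  h04 : bracket p q 0 4 ≤ 0
  h05 : bracket p q 0 5 ≤ 0
  h12 : 0 ≤ bracket p q 1 2
  h13 : 0 ≤ bracket p q 1 3
  h14 : bracket p q 1 4 ≤ 0
  h15 : bracket p q 1 5 ≤ 0
  h23 : 0 ≤ bracket p q 2 3
  h24 : 0 ≤ bracket p q 2 4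
  h25 : 0 ≤ bracket p q 2 5
  h34 : 0 ≤ bracket p q 3 4
  h35 : 0 ≤ bracket p q 3 5
  h45 : 0 ≤ bracket p q 4 5

/-- The signs of the brackets of the other simplicial polytope with six vertices, up to
degeneration. -/
structure IsWeakStacked (p q : Fin 6 → ℝ) : Prop where
  h01 : 0 ≤ bracket p q 0 1
  h02 : 0 ≤ bracket p q 0 2
  h03 : bracket p q 0 3 ≤ 0
  h04 : bracket p q 0 4 ≤ 0
  h05 : bracket p q 0 5 ≤ 0
  h12 : 0 ≤ bracket p q 1 2
  h13 : 0 ≤ bracket p q 1 3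
  h14 : bracket p q 1 4 ≤ 0
  h15 : bracket p q 1 5 ≤ 0
  h23 : 0 ≤ bracket p q 2 3
  h24 : 0 ≤ bracket p q 2 4
  h25 : bracket p q 2 5 ≤ 0
  h34 : 0 ≤ bracket p q 3 4
  h35 : 0 ≤ bracket p q 3 5
  h45 : 0 ≤ bracket p q 4 5

/-- If the only candidates for positive entries of the `i`-th row of brackets are at `j` and `l`,
these entries dominate the others. -/
theorem IsGale.row_le {p q : Fin 6 → ℝ} (h : IsGale p q) (i j l : Fin 6) (hjl : j ≠ l)
    (hj : 0 ≤ bracket p q i j) (hl : 0 ≤ bracket p q i l)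
    (hneg : ∀ k, k ≠ j → k ≠ l → bracket p q i k ≤ 0) (k : Fin 6) (hkj : k ≠ j) (hkl : k ≠ l) :
    -bracket p q i k ≤ bracket p q i j ∧ -bracket p q i k ≤ bracket p q i l :=
  (h.bracket_antipodal i).neg_le hjl hj hl hneg hkj hkl

theorem IsGale.row_le' {p q : Fin 6 → ℝ} (h : IsGale p q) (i j l : Fin 6) (hjl : j ≠ l)
    (hj : bracket p q i j ≤ 0) (hl : bracket p q i l ≤ 0)
    (hneg : ∀ k, k ≠ j → k ≠ l → 0 ≤ bracket p q i k) (k : Fin 6) (hkj : k ≠ j) (hkl : k ≠ l) :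
    bracket p q i k ≤ -bracket p q i j ∧ bracket p q i k ≤ -bracket p q i l := by
  have := (h.bracket_antipodal i).neg.neg_le hjl (by linarith) (by linarith)
    (fun k h1 h2 => by linarith [hneg k h1 h2]) hkj hkl
  simpa using this

theorem IsGale.row_sum {p q : Fin 6 → ℝ} (h : IsGale p q) (i : Fin 6) :
    bracket p q i 0 + bracket p q i 1 + bracket p q i 2 + bracket p q i 3 + bracket p q i 4
      + bracket p q i 5 = 0 := by
  simpa [Fin.sum_univ_six] using (h.bracket_antipodal i).1

theorem IsGale.row_ne {p q : Fin 6 → ℝ} (h : IsGale p q) (i : Fin 6)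
    (hz : ∀ k, bracket p q i k = 0) : False := by
  obtain ⟨j, hj⟩ := h.exists_ne i
  exact hj (hz j)

/-- The relations between the brackets in the weakly octahedral case. -/
theorem IsWeakOctahedral.relations {p q : Fin 6 → ℝ} (hw : IsWeakOctahedral p q)
    (h : IsGale p q) :
    (0 < bracket p q 0 2 ∧ bracket p q 2 4 = bracket p q 0 2 ∧
      bracket p q 0 4 = -bracket p q 0 2) ∧
    (0 < bracket p q 1 3 ∧ bracket p q 3 5 = bracket p q 1 3 ∧
      bracket p q 1 5 = -bracket p q 1 3) ∧
    (0 < bracket p q 1 2 ∧ 0 < bracket p q 3 4 ∧ bracket p q 0 5 < 0) ∧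
    (bracket p q 0 1 ≤ -bracket p q 0 4 ∧ bracket p q 0 2 ≤ -bracket p q 0 5 ∧
      bracket p q 2 3 ≤ bracket p q 0 2 ∧ bracket p q 1 3 ≤ bracket p q 3 4 ∧
      bracket p q 0 1 ≤ bracket p q 1 3 ∧ -bracket p q 1 4 ≤ bracket p q 2 4) := by
  have s := bracket_swap p q
  have d := bracket_self p q
  obtain ⟨h01, h02, h03, h04, h05, h12, h13, h14, h15, h23, h24, h25, h34, h35, h45⟩ := hw
  have s10 := s 0 1
  have s20 := s 0 2
  have s30 := s 0 3
  have s40 := s 0 4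
  have s50 := s 0 5
  have s21 := s 1 2
  have s31 := s 1 3
  have s41 := s 1 4
  have s51 := s 1 5
  have s32 := s 2 3
  have s42 := s 2 4
  have s52 := s 2 5
  have s43 := s 3 4
  have s53 := s 3 5
  have s54 := s 4 5
  have r0 := h.row_le' 0 4 5 (by decide) h04 h05
    (forall_fin_six.2 (by
      refine ⟨?_, ?_, ?_, ?_, ?_, ?_⟩ <;> intro hk hl <;>
        first | exact absurd rfl hk | exact absurd rfl hl | exact (d _).le |
          exact (d _).ge | linarith))
  have r1 := fun k hk hl => h.row_le 1 2 3 (by decide) h12 h13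
    (forall_fin_six.2 (by
      refine ⟨?_, ?_, ?_, ?_, ?_, ?_⟩ <;> intro hk hl <;>
        first | exact absurd rfl hk | exact absurd rfl hl | exact (d _).le |
          exact (d _).ge | linarith)) k hk hl
  have r2 := h.row_le' 2 0 1 (by decide) (by linarith) (by linarith)
    (forall_fin_six.2 (by
      refine ⟨?_, ?_, ?_, ?_, ?_, ?_⟩ <;> intro hk hl <;>
        first | exact absurd rfl hk | exact absurd rfl hl | exact (d _).le |
          exact (d _).ge | linarith))
  have r3 := fun k hk hl => h.row_le 3 4 5 (by decide) h34 h35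
    (forall_fin_six.2 (by
      refine ⟨?_, ?_, ?_, ?_, ?_, ?_⟩ <;> intro hk hl <;>
        first | exact absurd rfl hk | exact absurd rfl hl | exact (d _).le |
          exact (d _).ge | linarith)) k hk hl
  have r4 := h.row_le' 4 2 3 (by decide) (by linarith) (by linarith)
    (forall_fin_six.2 (by
      refine ⟨?_, ?_, ?_, ?_, ?_, ?_⟩ <;> intro hk hl <;>
        first | exact absurd rfl hk | exact absurd rfl hl | exact (d _).le |
          exact (d _).ge | linarith))
  have r5 := fun k hk hl => h.row_le 5 0 1 (by decide) (by linarith) (by linarith)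
    (forall_fin_six.2 (by
      refine ⟨?_, ?_, ?_, ?_, ?_, ?_⟩ <;> intro hk hl <;>
        first | exact absurd rfl hk | exact absurd rfl hl | exact (d _).le |
          exact (d _).ge | linarith)) k hk hl
  have r01 := r0 1 (by decide) (by decide)
  have r02 := r0 2 (by decide) (by decide)
  have r03 := r0 3 (by decide) (by decide)
  have r10 := r1 0 (by decide) (by decide)
  have r14 := r1 4 (by decide) (by decide)
  have r15 := r1 5 (by decide) (by decide)
  have r23 := r2 3 (by decide) (by decide)
  have r24 := r2 4 (by decide) (by decide)
  have r30 := r3 0 (by decide) (by decide)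
  have r31 := r3 1 (by decide) (by decide)
  have r32 := r3 2 (by decide) (by decide)
  have r40 := r4 0 (by decide) (by decide)
  have r41 := r4 1 (by decide) (by decide)
  have r53 := r5 3 (by decide) (by decide)
  have m0 := h.row_sum 0
  have m1 := h.row_sum 1
  have m3 := h.row_sum 3
  have d0 := d 0
  have d1 := d 1
  have d3 := d 3
  -- Rows `0`, `4`, `2` give `[02] ≤ [40] ≤ [24] ≤ [02]`, a closed cycle of inequalities; rows `1`,
  -- `5`, `3` do the same for the other triple.
  have c1 : bracket p q 2 4 = bracket p q 0 2 := by linarith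
  have c2 : bracket p q 0 4 = -bracket p q 0 2 := by linarith
  have c3 : bracket p q 3 5 = bracket p q 1 3 := by linarith
  have c4 : bracket p q 1 5 = -bracket p q 1 3 := by linarith
  have p02 : 0 < bracket p q 0 2 := by
    refine lt_of_le_of_ne h02 fun h0 => h.row_ne 0 (forall_fin_six.2 ?_)
    refine ⟨?_, ?_, ?_, ?_, ?_, ?_⟩ <;> linarith
  have p13 : 0 < bracket p q 1 3 := by
    refine lt_of_le_of_ne h13 fun h0 => h.row_ne 1 (forall_fin_six.2 ?_)
    refine ⟨?_, ?_, ?_, ?_, ?_, ?_⟩ <;> linarith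
  refine ⟨⟨p02, c1, c2⟩, ⟨p13, c3, c4⟩, ⟨by linarith, by linarith, by linarith⟩, ?_⟩
  refine ⟨by linarith, by linarith, by linarith, by linarith, by linarith, by linarith⟩

/-- The pattern is invariant under adding `2` to the indices, so the pairs `03`, `25`, `41` can be
treated alike. -/
theorem IsWeakOctahedral.rotate {p q : Fin 6 → ℝ} (hw : IsWeakOctahedral p q)
    {σ : Equiv.Perm (Fin 6)} (hσ : ⇑σ = ![2, 3, 4, 5, 0, 1]) :
    IsWeakOctahedral (p ∘ σ) (q ∘ σ) := by
  obtain ⟨h01, h02, h03, h04, h05, h12, h13, h14, h15, h23, h24, h25, h34, h35, h45⟩ := hw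
  simp only [bracket] at *
  constructor <;> simp [bracket, hσ] <;> linarith

/-- The degenerate case makes the vectors `0` and `3` exactly opposite; together with the vanishing
sum of the triple `0, 2, 4` this is the diagram of a skew prism whose top edge is the pair `0, 3`.
-/
theorem IsWeakOctahedral.isClassified_of_eq_zero {p q : Fin 6 → ℝ} (hw : IsWeakOctahedral p q)
    (h : IsGale p q) (h03 : bracket p q 0 3 = 0) : IsClassified p q := by
  obtain ⟨⟨a1, a2, a3⟩, ⟨b1, b2, b3⟩, ⟨c1, c2, c3⟩, e1, e2, e3, e4, e5, e6⟩ := hw.relations h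
  have s10 := bracket_swap p q 0 1
  have s20 := bracket_swap p q 0 2
  have s30 := bracket_swap p q 0 3
  have s31 := bracket_swap p q 1 3
  have s32 := bracket_swap p q 2 3
  have m0 := h.row_sum 0
  have m1 := h.row_sum 1
  have m3 := h.row_sum 3
  have d0 := bracket_self p q 0
  have d1 := bracket_self p q 1
  have d3 := bracket_self p q 3
  have f1 : bracket p q 0 1 = bracket p q 0 2 := by linarith
  have f2 : bracket p q 2 3 = bracket p q 0 2 := by linarith
  have z : p 0 + p 3 = 0 ∧ q 0 + q 3 = 0 := by
    apply eq_zero_of_bracket (a := p 0) (b := p 2) (c := q 0) (d := q 2)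
    · simp only [bracket] at a1; linarith
    · simp only [bracket] at h03; linarith
    · simp only [bracket] at f2; linarith
  have z' : p 0 + p 2 + p 4 = 0 ∧ q 0 + q 2 + q 4 = 0 := by
    apply eq_zero_of_bracket (a := p 0) (b := p 2) (c := q 0) (d := q 2)
    · simp only [bracket] at a1; linarith
    · simp only [bracket] at a3; linarith
    · simp only [bracket] at a2; linarith
  have h12 := hw.h12
  refine IsClassified.of_comp (Equiv.ofBijective ![2, 5, 1, 4, 0, 3] (by decide))
    (isClassified_of_opposite (h.comp _) ?_ ?_ ?_ ?_ ?_ ?_ ?_ ?_) <;>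
    simp [bracket] at * <;> linarith

/-- Only the brackets `03`, `25`, `14` may still vanish among those that must be strict. If one
does, a rotation reduces to the prism case; if none does, the octahedral diagram is strict. -/
theorem IsWeakOctahedral.isClassified {p q : Fin 6 → ℝ} (hw : IsWeakOctahedral p q)
    (h : IsGale p q) : IsClassified p q := by
  set σ : Equiv.Perm (Fin 6) := Equiv.ofBijective ![2, 3, 4, 5, 0, 1] (by decide) with hσ
  have hσ' : ⇑σ = ![2, 3, 4, 5, 0, 1] := rfl
  by_cases z1 : bracket p q 0 3 = 0
  · exact hw.isClassified_of_eq_zero h z1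
  by_cases z2 : bracket p q 2 5 = 0
  · refine .of_comp σ ((hw.rotate hσ').isClassified_of_eq_zero (h.comp σ) ?_)
    simpa [bracket, hσ'] using z2
  by_cases z3 : bracket p q 1 4 = 0
  · refine .of_comp σ (.of_comp σ (((hw.rotate hσ').rotate hσ').isClassified_of_eq_zero
      ((h.comp σ).comp σ) ?_))
    have := bracket_swap p q 1 4
    rw [z3] at this
    simpa [bracket, hσ'] using this
  obtain ⟨⟨a1, a2, a3⟩, ⟨b1, b2, b3⟩, ⟨c1, c2, c3⟩, -⟩ := hw.relations h
  have z' : p 0 + p 2 + p 4 = 0 ∧ q 0 + q 2 + q 4 = 0 := by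
    apply eq_zero_of_bracket (a := p 0) (b := p 2) (c := q 0) (d := q 2)
    · simp only [bracket] at a1; linarith
    · simp only [bracket] at a3; linarith
    · simp only [bracket] at a2; linarith
  have s40 := bracket_swap p q 0 4
  have s50 := bracket_swap p q 0 5
  have s41 := bracket_swap p q 1 4
  have s51 := bracket_swap p q 1 5
  have h14 := lt_of_le_of_ne hw.h14 z3
  refine ⟨1, Or.inl ⟨z'.1, z'.2, hw.h01, hw.h23, hw.h45, a1, ?_, c1, b1, ?_, ?_, c2, ?_, ?_, ?_,
    ?_, ?_⟩⟩
  · exact lt_of_le_of_ne hw.h03 (Ne.symm z1)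
  · exact a1.trans_eq a2.symm
  · exact lt_of_le_of_ne hw.h25 (Ne.symm z2)
  · exact b1.trans_eq b2.symm
  all_goals simp only [Equiv.Perm.coe_one, Function.comp_id]; linarith

/-- The row inequalities leave no room in a Plücker relation: the vectors `1` and `4` must be
opposite, so the stacked polytope only occurs degenerated to a skew prism with top edge `4, 1`. -/
theorem IsWeakStacked.isClassified {p q : Fin 6 → ℝ} (hw : IsWeakStacked p q)
    (h : IsGale p q) : IsClassified p q := by
  obtain ⟨h01, h02, h03, h04, h05, h12, h13, h14, h15, h23, h24, h25, h34, h35, h45⟩ := hw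
  have s10 := bracket_swap p q 0 1
  have s20 := bracket_swap p q 0 2
  have s30 := bracket_swap p q 0 3
  have s40 := bracket_swap p q 0 4
  have s50 := bracket_swap p q 0 5
  have s21 := bracket_swap p q 1 2
  have s31 := bracket_swap p q 1 3
  have s41 := bracket_swap p q 1 4
  have s51 := bracket_swap p q 1 5
  have s32 := bracket_swap p q 2 3
  have s42 := bracket_swap p q 2 4
  have s52 := bracket_swap p q 2 5
  have s43 := bracket_swap p q 3 4
  have s53 := bracket_swap p q 3 5
  have s54 := bracket_swap p q 4 5
  have d := bracket_self p q
  have r0 := fun k hk hl => h.row_le 0 1 2 (by decide) h01 h02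
    (forall_fin_six.2 (by
      refine ⟨?_, ?_, ?_, ?_, ?_, ?_⟩ <;> intro hk hl <;>
        first | exact absurd rfl hk | exact absurd rfl hl | exact (d _).le |
          exact (d _).ge | linarith)) k hk hl
  have r1 := fun k hk hl => h.row_le 1 2 3 (by decide) h12 h13
    (forall_fin_six.2 (by
      refine ⟨?_, ?_, ?_, ?_, ?_, ?_⟩ <;> intro hk hl <;>
        first | exact absurd rfl hk | exact absurd rfl hl | exact (d _).le |
          exact (d _).ge | linarith)) k hk hl
  have r2 := fun k hk hl => h.row_le 2 3 4 (by decide) h23 h24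
    (forall_fin_six.2 (by
      refine ⟨?_, ?_, ?_, ?_, ?_, ?_⟩ <;> intro hk hl <;>
        first | exact absurd rfl hk | exact absurd rfl hl | exact (d _).le |
          exact (d _).ge | linarith)) k hk hl
  have r3 := h.row_le' 3 1 2 (by decide) (by linarith) (by linarith)
    (forall_fin_six.2 (by
      refine ⟨?_, ?_, ?_, ?_, ?_, ?_⟩ <;> intro hk hl <;>
        first | exact absurd rfl hk | exact absurd rfl hl | exact (d _).le |
          exact (d _).ge | linarith))
  have r4 := h.row_le' 4 2 3 (by decide) (by linarith) (by linarith)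
    (forall_fin_six.2 (by
      refine ⟨?_, ?_, ?_, ?_, ?_, ?_⟩ <;> intro hk hl <;>
        first | exact absurd rfl hk | exact absurd rfl hl | exact (d _).le |
          exact (d _).ge | linarith))
  have r03 := r0 3 (by decide) (by decide)
  have r04 := r0 4 (by decide) (by decide)
  have r05 := r0 5 (by decide) (by decide)
  have r10 := r1 0 (by decide) (by decide)
  have r14 := r1 4 (by decide) (by decide)
  have r15 := r1 5 (by decide) (by decide)
  have r20 := r2 0 (by decide) (by decide)
  have r21 := r2 1 (by decide) (by decide)
  have r25 := r2 5 (by decide) (by decide)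
  have r30 := r3 0 (by decide) (by decide)
  have r34 := r3 4 (by decide) (by decide)
  have r35 := r3 5 (by decide) (by decide)
  have r40 := r4 0 (by decide) (by decide)
  have r41 := r4 1 (by decide) (by decide)
  have r45 := r4 5 (by decide) (by decide)
  have m0 := h.row_sum 0
  have m1 := h.row_sum 1
  have m2 := h.row_sum 2
  have m4 := h.row_sum 4
  have d0 := d 0
  have d1 := d 1
  have d2 := d 2
  have d4 := d 4
  have pl : bracket p q 1 2 * bracket p q 3 4 - bracket p q 1 3 * bracket p q 2 4
      + bracket p q 1 4 * bracket p q 2 3 = 0 := by simp only [bracket]; ring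
  have p23 : 0 < bracket p q 2 3 := by
    refine lt_of_le_of_ne h23 fun h0 => h.row_ne 2 (forall_fin_six.2 ?_)
    refine ⟨?_, ?_, ?_, ?_, ?_, ?_⟩ <;> linarith
  -- Rows `2` and `3` give `[12] ≤ [24]` and `[34] ≤ [13]`. The Plücker relation then makes
  -- `[14][23]` nonnegative, while `[14] ≤ 0 < [23]`.
  have z14 : bracket p q 1 4 = 0 := by
    have : bracket p q 1 2 * bracket p q 3 4 ≤ bracket p q 1 3 * bracket p q 2 4 := by
      rw [mul_comm (bracket p q 1 3)]
      exact mul_le_mul (by linarith) (by linarith) h34 h24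
    by_contra hz
    have := mul_neg_of_neg_of_pos (lt_of_le_of_ne h14 hz) p23
    linarith
  have p12 : 0 < bracket p q 1 2 := by
    refine lt_of_le_of_ne h12 fun h0 => h.row_ne 1 (forall_fin_six.2 ?_)
    refine ⟨?_, ?_, ?_, ?_, ?_, ?_⟩ <;> linarith
  have f1 : bracket p q 2 4 = bracket p q 1 2 := by linarith
  have f2 : bracket p q 0 4 = -bracket p q 1 2 := by linarith
  have f3 : bracket p q 4 5 = bracket p q 1 2 := by linarith
  have f4 : bracket p q 0 2 = bracket p q 1 2 := by linarith
  have z : p 1 + p 4 = 0 ∧ q 1 + q 4 = 0 := by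
    apply eq_zero_of_bracket (a := p 1) (b := p 2) (c := q 1) (d := q 2)
    · simp only [bracket] at p12; linarith
    · simp only [bracket] at z14; linarith
    · simp only [bracket] at f1; linarith
  have z' : p 0 + p 2 + p 4 = 0 ∧ q 0 + q 2 + q 4 = 0 := by
    apply eq_zero_of_bracket (a := p 0) (b := p 2) (c := q 0) (d := q 2)
    · simp only [bracket] at f4 p12; linarith
    · simp only [bracket] at f2 f4; linarith
    · simp only [bracket] at f1 f4; linarith
  have g1 : 0 < bracket p q 4 0 := by linarith
  have g2 : bracket p q 4 5 = bracket p q 4 0 := by linarith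
  have g3 : 0 ≤ bracket p q 5 0 := by linarith
  have g4 : bracket p q 5 0 ≤ 2 * bracket p q 4 0 := by linarith
  exact IsClassified.of_comp (Equiv.ofBijective ![0, 3, 5, 2, 4, 1] (by decide))
    (isClassified_of_opposite (h.comp _) ((add_comm _ _).trans z.1) ((add_comm _ _).trans z.2)
      z'.1 z'.2 g1 g2 g3 g4)

/-! ### Enumeration of the sign patterns -/

/-- The lines spanned by the vectors `(p k, q k)` are sorted by slope, and `ε k` tells on which
side of the origin the vector lies. -/
def SignSorted (ε : Fin 6 → Bool) (p q : Fin 6 → ℝ) : Prop :=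
  ∀ i j, i < j → if ε i = ε j then 0 ≤ bracket p q i j else bracket p q i j ≤ 0

/-- The predicted weak sign of the bracket of `i` and `k`. -/
def bracketSign (ε : Fin 6 → Bool) (i k : Fin 6) : Bool :=
  if i < k then ε i == ε k else ε i != ε k

/-- Every row has two candidates for positive and two candidates for negative entries. -/
def IsBalanced (ε : Fin 6 → Bool) : Prop :=
  ∀ i j, ∀ b : Bool, ∃ k, k ≠ j ∧ k ≠ i ∧ bracketSign ε i k = b

instance (ε : Fin 6 → Bool) : Decidable (IsBalanced ε) := by
  unfold IsBalanced; infer_instance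

/-- Moving the first line to the end. -/
def shiftSigns (ε : Fin 6 → Bool) : Fin 6 → Bool :=
  ![ε 1, ε 2, ε 3, ε 4, ε 5, !ε 0]

theorem SignSorted.bracket_sign {ε : Fin 6 → Bool} {p q : Fin 6 → ℝ} (h : SignSorted ε p q)
    {i k : Fin 6} (hik : i ≠ k) :
    if bracketSign ε i k then 0 ≤ bracket p q i k else bracket p q i k ≤ 0 := by
  rcases lt_or_gt_of_ne hik with hlt | hgt
  · simpa [bracketSign, hlt] using h i k hlt
  · have := h k i hgt
    rw [bracket_swap p q k i]
    by_cases he : ε k = ε i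
    · simpa [bracketSign, hgt.not_gt, he] using this
    · simpa [bracketSign, hgt.not_gt, he, Ne.symm he] using this

/-- By `AntipodalVector.exists_pos`, each row and its negative have a positive entry away from any
given index. Strict entries must agree with the predicted weak sign, and the diagonal entry is zero.
-/
theorem SignSorted.isBalanced {ε : Fin 6 → Bool} {p q : Fin 6 → ℝ} (h : SignSorted ε p q)
    (hg : IsGale p q) : IsBalanced ε := by
  intro i j b
  have hi := bracket_self p q i
  cases b
  · have hne : ∃ k, -bracket p q i k ≠ 0 := by simpa using hg.exists_ne i
    obtain ⟨k, hkj, hk⟩ := (hg.bracket_antipodal i).neg.exists_pos hne j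
    have hki : k ≠ i := by rintro rfl; linarith
    refine ⟨k, hkj, hki, ?_⟩
    have := h.bracket_sign hki.symm
    by_contra hs
    rw [if_pos (by simpa using hs)] at this
    linarith
  · obtain ⟨k, hkj, hk⟩ := (hg.bracket_antipodal i).exists_pos (hg.exists_ne i) j
    have hki : k ≠ i := by rintro rfl; linarith
    refine ⟨k, hkj, hki, ?_⟩
    have := h.bracket_sign hki.symm
    by_contra hs
    rw [if_neg hs] at this
    linarith

/-- Slopes are only cyclically ordered. When the first line moves to the end, its brackets with the
others are read in the opposite order, so its side has to be negated. -/
theorem SignSorted.shift {ε : Fin 6 → Bool} {p q : Fin 6 → ℝ} (h : SignSorted ε p q) :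
    SignSorted (shiftSigns ε) (p ∘ finRotate 6) (q ∘ finRotate 6) := by
  have key : ∀ i j : Fin 6, i < j → j ≠ 5 → i + 1 < j + 1 := by decide
  have key' : ∀ i : Fin 6, i < 5 → 0 < i + 1 := by decide
  have hs : ∀ i : Fin 6, i ≠ 5 → shiftSigns ε i = ε (i + 1) := by
    intro i hi
    fin_cases i <;> first | rfl | exact absurd rfl hi
  intro i j hij
  have hi : i ≠ 5 := fun h5 => by subst h5; revert hij; revert j; decide
  simp only [bracket, Function.comp_apply, finRotate_apply]
  by_cases hj : j = 5
  · subst hj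
    have h0 := h 0 (i + 1) (key' i hij)
    rw [hs i hi, show shiftSigns ε 5 = !ε 0 from rfl, show (5 : Fin 6) + 1 = 0 from rfl]
    simp only [bracket] at h0
    by_cases he : ε 0 = ε (i + 1)
    · rw [if_pos he] at h0
      rw [if_neg (by simp [he])]
      linarith
    · rw [if_neg he] at h0
      rw [if_pos (by cases h1 : ε 0 <;> cases h2 : ε (i + 1) <;> simp_all)]
      linarith
  · rw [hs i hi, hs j hj]
    exact h _ _ (key i j hij hj)

/-- A finite check of the 64 patterns; twelve shifts restore a pattern, since six negate every side.
-/
theorem IsBalanced.exists_shift : ∀ ε : Fin 6 → Bool, IsBalanced ε →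
    ∃ n : Fin 12, shiftSigns^[n] ε = ![true, true, false, false, true, true] ∨
      shiftSigns^[n] ε = ![true, false, true, false, true, false] := by
  decide +kernel

theorem SignSorted.isClassified_of_shift (n : ℕ) : ∀ {ε : Fin 6 → Bool} {p q : Fin 6 → ℝ},
    SignSorted ε p q → IsGale p q →
    (shiftSigns^[n] ε = ![true, true, false, false, true, true] ∨
      shiftSigns^[n] ε = ![true, false, true, false, true, false]) → IsClassified p q := by
  induction n with
  | zero =>
    intro ε p q h hg hε
    rcases hε with hε | hε <;> simp only [Function.iterate_zero, id] at hε <;> subst hε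
    · refine .of_comp (Equiv.ofBijective ![0, 1, 4, 5, 2, 3] (by decide))
        (IsWeakOctahedral.isClassified ?_ (hg.comp _))
      exact ⟨h.bracket_sign (i := 0) (k := 1) (by decide),
        h.bracket_sign (i := 0) (k := 4) (by decide), h.bracket_sign (i := 0) (k := 5) (by decide),
        h.bracket_sign (i := 0) (k := 2) (by decide), h.bracket_sign (i := 0) (k := 3) (by decide),
        h.bracket_sign (i := 1) (k := 4) (by decide), h.bracket_sign (i := 1) (k := 5) (by decide),
        h.bracket_sign (i := 1) (k := 2) (by decide), h.bracket_sign (i := 1) (k := 3) (by decide),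
        h.bracket_sign (i := 4) (k := 5) (by decide), h.bracket_sign (i := 4) (k := 2) (by decide),
        h.bracket_sign (i := 4) (k := 3) (by decide), h.bracket_sign (i := 5) (k := 2) (by decide),
        h.bracket_sign (i := 5) (k := 3) (by decide), h.bracket_sign (i := 2) (k := 3) (by decide)⟩
    · refine .of_comp (Equiv.ofBijective ![0, 2, 4, 1, 3, 5] (by decide))
        (IsWeakStacked.isClassified ?_ (hg.comp _))
      exact ⟨h.bracket_sign (i := 0) (k := 2) (by decide),
        h.bracket_sign (i := 0) (k := 4) (by decide), h.bracket_sign (i := 0) (k := 1) (by decide),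
        h.bracket_sign (i := 0) (k := 3) (by decide), h.bracket_sign (i := 0) (k := 5) (by decide),
        h.bracket_sign (i := 2) (k := 4) (by decide), h.bracket_sign (i := 2) (k := 1) (by decide),
        h.bracket_sign (i := 2) (k := 3) (by decide), h.bracket_sign (i := 2) (k := 5) (by decide),
        h.bracket_sign (i := 4) (k := 1) (by decide), h.bracket_sign (i := 4) (k := 3) (by decide),
        h.bracket_sign (i := 4) (k := 5) (by decide), h.bracket_sign (i := 1) (k := 3) (by decide),
        h.bracket_sign (i := 1) (k := 5) (by decide), h.bracket_sign (i := 3) (k := 5) (by decide)⟩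
  | succ n ih =>
    intro ε p q h hg hε
    exact .of_comp (finRotate 6) (ih h.shift (hg.comp _) hε)

/-- The classification of the Gale diagrams of antipodal sets of six points. -/
theorem IsGale.isClassified {p q : Fin 6 → ℝ} (h : IsGale p q) (hp : ∀ k, p k ≠ 0) :
    IsClassified p q := by
  -- Slopes make sense because no `p k` vanishes. Ties give zero brackets, compatible with both weak
  -- signs.
  set σ := Tuple.sort fun k => q k / p k
  have hmono : Monotone ((fun k => q k / p k) ∘ σ) := Tuple.monotone_sort _
  have hg := h.comp σ
  have hs : SignSorted (fun k => decide (0 < p (σ k))) (p ∘ σ) (q ∘ σ) := by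
    intro i j hij
    have hm : 0 ≤ q (σ j) / p (σ j) - q (σ i) / p (σ i) := sub_nonneg.2 (hmono hij.le)
    have hb : bracket (p ∘ σ) (q ∘ σ) i j
        = p (σ i) * p (σ j) * (q (σ j) / p (σ j) - q (σ i) / p (σ i)) := by
      have h1 := hp (σ i)
      have h2 := hp (σ j)
      simp only [bracket, Function.comp_apply]
      field_simp
    rw [hb]
    rcases lt_or_gt_of_ne (hp (σ i)) with hi | hi <;>
      rcases lt_or_gt_of_ne (hp (σ j)) with hj | hj
    · rw [if_pos (by simp [hi.not_gt, hj.not_gt])]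
      exact mul_nonneg (mul_nonneg_of_nonpos_of_nonpos hi.le hj.le) hm
    · rw [if_neg (by simp [hi.not_gt, hj])]
      exact mul_nonpos_of_nonpos_of_nonneg (mul_nonpos_of_nonpos_of_nonneg hi.le hj.le) hm
    · rw [if_neg (by simp [hi, hj.not_gt])]
      exact mul_nonpos_of_nonpos_of_nonneg (mul_nonpos_of_nonneg_of_nonpos hi.le hj.le) hm
    · rw [if_pos (by simp [hi, hj])]
      exact mul_nonneg (mul_nonneg hi.le hj.le) hm
  obtain ⟨n, hn⟩ := IsBalanced.exists_shift _ (hs.isBalanced hg)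
  exact .of_comp σ (hs.isClassified_of_shift n hg hn)

/-! ### Dimension of the space of dependences -/

/-- With only four entries left, the inequalities force equal absolute values: four coplanar points
of an antipodal set form a parallelogram. -/
theorem AntipodalVector.sq_eq {φ : Fin 6 → ℝ} (h : AntipodalVector φ) (h4 : φ 4 = 0)
    (h5 : φ 5 = 0) : φ 1 ^ 2 = φ 0 ^ 2 ∧ φ 2 ^ 2 = φ 0 ^ 2 ∧ φ 3 ^ 2 = φ 0 ^ 2 := by
  have hs := h.1
  have key : ∀ i j, i ≠ j → (φ i - φ j) + |φ i| + |φ j| ≤ |φ 0| + |φ 1| + |φ 2| + |φ 3| := by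
    intro i j hij
    have := h.2 i j hij
    simp only [Fin.sum_univ_six, h4, h5, abs_zero, add_zero] at this
    linarith [le_abs_self (φ i - φ j)]
  simp only [Fin.sum_univ_six, h4, h5, add_zero] at hs
  have k01 := key 0 1 (by decide)
  have k10 := key 1 0 (by decide)
  have k02 := key 0 2 (by decide)
  have k20 := key 2 0 (by decide)
  have k03 := key 0 3 (by decide)
  have k30 := key 3 0 (by decide)
  have k12 := key 1 2 (by decide)
  have k21 := key 2 1 (by decide)
  have k13 := key 1 3 (by decide)
  have k31 := key 3 1 (by decide)
  have k23 := key 2 3 (by decide)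
  have k32 := key 3 2 (by decide)
  clear key
  have : |φ 1| = |φ 0| ∧ |φ 2| = |φ 0| ∧ |φ 3| = |φ 0| := by
    rcases abs_cases (φ 0) with ⟨e0, _⟩ | ⟨e0, _⟩ <;>
    rcases abs_cases (φ 1) with ⟨e1, _⟩ | ⟨e1, _⟩ <;>
    rcases abs_cases (φ 2) with ⟨e2, _⟩ | ⟨e2, _⟩ <;>
    rcases abs_cases (φ 3) with ⟨e3, _⟩ | ⟨e3, _⟩ <;>
    refine ⟨?_, ?_, ?_⟩ <;> linarith
  exact ⟨sq_eq_sq_iff_abs_eq_abs _ _ |>.2 this.1, sq_eq_sq_iff_abs_eq_abs _ _ |>.2 this.2.1,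
    sq_eq_sq_iff_abs_eq_abs _ _ |>.2 this.2.2⟩

/-- In a space of antipodal vectors, there are not two nonzero ones such that one of them vanishes
at `4` and `5`, and the other at `3` and `5`. -/
theorem eq_zero_of_antipodalVector {D : Submodule ℝ (Fin 6 → ℝ)}
    (hD : ∀ φ ∈ D, AntipodalVector φ) {φ ψ : Fin 6 → ℝ} (hφ : φ ∈ D) (hψ : ψ ∈ D)
    (h4 : φ 4 = 0) (h5 : φ 5 = 0) (h3' : ψ 3 = 0) (h5' : ψ 5 = 0) : φ = 0 ∨ ψ = 0 := by
  obtain ⟨a1, a2, a3⟩ := (hD φ hφ).sq_eq h4 h5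
  have hb := ((hD ψ hψ).comp (Equiv.swap 3 4)).sq_eq (by simpa using h3')
    (by simpa [Equiv.swap_apply_of_ne_of_ne] using h5')
  -- The combination `ψ 0 • φ - φ 0 • ψ` vanishes at `0` and `5`, so its other four entries also
  -- agree up to sign.
  have hχ := hD _ (D.sub_mem (D.smul_mem (ψ 0) hφ) (D.smul_mem (φ 0) hψ))
  have hc := (hχ.comp (Equiv.swap 0 4)).sq_eq (by simp; ring)
    (by simp [Equiv.swap_apply_of_ne_of_ne, h5, h5'])
  simp only [Function.comp_apply, Equiv.swap_apply_left,
    show Equiv.swap (3 : Fin 6) 4 0 = 0 from by decide,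
    show Equiv.swap (3 : Fin 6) 4 1 = 1 from by decide,
    show Equiv.swap (3 : Fin 6) 4 2 = 2 from by decide] at hb
  obtain ⟨b1, b2, b4⟩ := hb
  simp only [Function.comp_apply, Equiv.swap_apply_left,
    show Equiv.swap (0 : Fin 6) 4 1 = 1 from by decide,
    show Equiv.swap (0 : Fin 6) 4 2 = 2 from by decide,
    show Equiv.swap (0 : Fin 6) 4 3 = 3 from by decide, Pi.sub_apply, Pi.smul_apply,
    smul_eq_mul, h4, h3'] at hc
  obtain ⟨c1, -, c3⟩ := hc
  -- The entry at `3` is `± φ 0 * ψ 0`, whereas the entry at `1` is `0` or `± 2 * φ 0 * ψ 0`.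
  have hprod : φ 0 * ψ 0 = 0 := by
    have e3 : (φ 0 * ψ 0) ^ 2 = (ψ 0 * φ 1 - φ 0 * ψ 1) ^ 2 := by
      rw [c1, ← c3, mul_zero, sub_zero, mul_pow, mul_pow, a3, mul_comm]
    rcases sq_eq_sq_iff_eq_or_eq_neg.1 a1 with h | h <;>
      rcases sq_eq_sq_iff_eq_or_eq_neg.1 b1 with h' | h' <;> rw [h, h'] at e3 <;>
      refine pow_eq_zero_iff two_ne_zero |>.1 ?_ <;> linarith
  rcases mul_eq_zero.1 hprod with h | h
  · left
    rw [h] at a1 a2 a3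
    funext k
    fin_cases k <;> simp_all
  · right
    rw [h] at b1 b2 b4
    funext k
    fin_cases k <;> simp_all

theorem exists_ne_zero_of_lt_finrank {D : Submodule ℝ (Fin 6 → ℝ)} {n : ℕ} (f : Fin n → Fin 6)
    (h : n < Module.finrank ℝ D) : ∃ φ ∈ D, φ ≠ 0 ∧ ∀ k, φ (f k) = 0 := by
  have hk : LinearMap.ker ((LinearMap.funLeft ℝ ℝ f).comp D.subtype) ≠ ⊥ :=
    LinearMap.ker_ne_bot_of_finrank_lt (by simpa using h)
  obtain ⟨φ, hφ, hne⟩ := (Submodule.ne_bot_iff _).1 hk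
  refine ⟨φ, φ.2, by simpa using hne, fun k => ?_⟩
  exact congrFun (LinearMap.mem_ker.1 hφ) k

/-- A space of dimension three would contain nonzero vectors with prescribed zeros at `4, 5` and at
`3, 5`. -/
theorem finrank_le_two_of_antipodalVector {D : Submodule ℝ (Fin 6 → ℝ)}
    (hD : ∀ φ ∈ D, AntipodalVector φ) : Module.finrank ℝ D ≤ 2 := by
  by_contra! h
  obtain ⟨φ, hφ, hne, hz⟩ := exists_ne_zero_of_lt_finrank ![4, 5] h
  obtain ⟨ψ, hψ, hne', hz'⟩ := exists_ne_zero_of_lt_finrank ![3, 5] h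
  rcases eq_zero_of_antipodalVector hD hφ hψ (hz 0) (hz 1) (hz' 0) (hz' 1) with h | h
  · exact hne h
  · exact hne' h

/-- If the entry at `5` always vanished, one further linear condition at `4` or at `3` would already
give the forbidden pair. So no Gale vector is zero, and no point is the apex of a pyramid over the
other five. -/
theorem exists_apply_five_ne_zero {D : Submodule ℝ (Fin 6 → ℝ)}
    (hD : ∀ φ ∈ D, AntipodalVector φ) (h2 : Module.finrank ℝ D = 2) : ∃ φ ∈ D, φ 5 ≠ 0 := by
  by_contra! hz5
  obtain ⟨φ, hφ, hne, hz⟩ := exists_ne_zero_of_lt_finrank (D := D) ![4] (by omega)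
  obtain ⟨ψ, hψ, hne', hz'⟩ := exists_ne_zero_of_lt_finrank (D := D) ![3] (by omega)
  rcases eq_zero_of_antipodalVector hD hφ hψ (hz 0) (hz5 φ hφ) (hz' 0) (hz5 ψ hψ) with h | h
  · exact hne h
  · exact hne' h

theorem exists_apply_ne_zero {D : Submodule ℝ (Fin 6 → ℝ)}
    (hD : ∀ φ ∈ D, AntipodalVector φ) (h2 : Module.finrank ℝ D = 2) (i : Fin 6) :
    ∃ φ ∈ D, φ i ≠ 0 := by
  set e := LinearEquiv.funCongrLeft ℝ ℝ (Equiv.swap 5 i)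
  obtain ⟨φ, hφ, hne⟩ := exists_apply_five_ne_zero (D := D.map (e : _ →ₗ[ℝ] _))
    (by rintro _ ⟨φ, hφ, rfl⟩; exact (hD φ hφ).comp (Equiv.swap 5 i))
    (by rw [LinearEquiv.finrank_map_eq, h2])
  obtain ⟨φ, hφ, rfl⟩ := hφ
  refine ⟨φ, hφ, ?_⟩
  simpa [e, LinearEquiv.funCongrLeft] using hne

/-- A basis of a two-dimensional space of antipodal vectors, the first element of which has no zero
entries. -/
theorem exists_isGale {D : Submodule ℝ (Fin 6 → ℝ)}
    (hD : ∀ φ ∈ D, AntipodalVector φ) (h2 : Module.finrank ℝ D = 2) :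
    ∃ p ∈ D, ∃ q ∈ D, IsGale p q ∧ ∀ k, p k ≠ 0 := by
  let b := Module.finBasisOfFinrankEq ℝ D h2
  set p₀ : Fin 6 → ℝ := (b 0).1 with hp₀
  set q : Fin 6 → ℝ := (b 1).1 with hq
  have hspan : ∀ φ ∈ D, ∃ x y : ℝ, φ = x • p₀ + y • q := by
    intro φ hφ
    have := b.sum_repr ⟨φ, hφ⟩
    rw [Fin.sum_univ_two] at this
    exact ⟨_, _, (congrArg Subtype.val this).symm⟩
  have hind : ∀ x y : ℝ, x • p₀ + y • q = 0 → x = 0 ∧ y = 0 := by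
    intro x y hxy
    have := Fintype.linearIndependent_iff.1 b.linearIndependent ![x, y]
      (by rw [Fin.sum_univ_two]; exact Subtype.ext hxy)
    exact ⟨this 0, this 1⟩
  have hne : ∀ k, p₀ k ≠ 0 ∨ q k ≠ 0 := by
    intro k
    by_contra! hc
    obtain ⟨φ, hφ, hk⟩ := exists_apply_ne_zero hD h2 k
    obtain ⟨x, y, rfl⟩ := hspan φ hφ
    simp [hc.1, hc.2] at hk
  -- Each `k` with `q k ≠ 0` excludes one value of `t`. If `q k = 0`, the quotient is the default
  -- `0`, which harmlessly excludes `t = 0`.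
  obtain ⟨t, ht⟩ := Infinite.exists_notMem_finset (Finset.univ.image fun k => -p₀ k / q k)
  have hp : ∀ k, (p₀ + t • q) k ≠ 0 := by
    intro k hk
    simp only [Pi.add_apply, Pi.smul_apply, smul_eq_mul] at hk
    have hqk : q k ≠ 0 := by
      intro h0
      rw [h0, mul_zero, add_zero] at hk
      exact (hne k).elim (· hk) (· h0)
    refine ht (Finset.mem_image.2 ⟨k, Finset.mem_univ _, ?_⟩)
    rw [div_eq_iff hqk]; linarith
  have hpD : p₀ + t • q ∈ D := D.add_mem (b 0).2 (D.smul_mem _ (b 1).2)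
  refine ⟨p₀ + t • q, hpD, q, (b 1).2, ⟨fun x y => ?_, fun i => ?_⟩, hp⟩
  · exact hD _ (D.add_mem (D.smul_mem x hpD) (D.smul_mem y (b 1).2))
  · by_contra! hc
    -- A zero row means `-q i • p + p i • q = 0`; these are its coefficients in the original basis
    -- `p₀, q`.
    obtain ⟨-, h1⟩ := hind (-q i) ((p₀ + t • q) i - t * q i) (by
      funext j
      have := hc j
      simp only [bracket, Pi.add_apply, Pi.smul_apply, smul_eq_mul, Pi.zero_apply] at this ⊢
      linarith)
    obtain ⟨h0, -⟩ := hind (-q i) ((p₀ + t • q) i - t * q i) (by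
      funext j
      have := hc j
      simp only [bracket, Pi.add_apply, Pi.smul_apply, smul_eq_mul, Pi.zero_apply] at this ⊢
      linarith)
    refine hp i ?_
    rw [neg_eq_zero.1 h0] at h1
    linarith

/-! ### From the points to their dependences -/

/-- The space of affine dependences of six points. -/
def affineDeps (s : Fin 6 → Space3) : Submodule ℝ (Fin 6 → ℝ) :=
  LinearMap.ker (Fintype.linearCombination ℝ fun i => ((1 : ℝ), s i))

theorem mem_affineDeps {s : Fin 6 → Space3} {φ : Fin 6 → ℝ} :
    φ ∈ affineDeps s ↔ ∑ i, φ i = 0 ∧ ∑ i, φ i • s i = 0 := by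
  rw [affineDeps, LinearMap.mem_ker, Fintype.linearCombination_apply, Prod.ext_iff]
  simp [Prod.fst_sum, Prod.snd_sum]

theorem sum_mul_eq_zero_of_mem_affineDeps {s : Fin 6 → Space3} {φ : Fin 6 → ℝ}
    (h : φ ∈ affineDeps s) (l : Space3 →L[ℝ] ℝ) (c : ℝ) : ∑ i, φ i * (l (s i) + c) = 0 := by
  obtain ⟨h1, h2⟩ := mem_affineDeps.1 h
  have h3 := congrArg l h2
  simp only [map_sum, map_smul, smul_eq_mul, map_zero] at h3
  simp only [mul_add, Finset.sum_add_distrib, ← Finset.sum_mul, h1, h3]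
  simp

/-- The separating functional, shifted by `m`, has values in `[-d/2, d/2]` with the extremes at `s
i` and `s j`. Each term `φ k * (f (s k) + m) + |φ k| * (d / 2)` is nonnegative, so the two at `i`
and `j` are bounded by the whole sum. -/
theorem antipodalVector_of_mem_affineDeps {s : Fin 6 → Space3} (hs : Function.Injective s)
    (h : IsAntipodal (Set.range s)) {φ : Fin 6 → ℝ} (hφ : φ ∈ affineDeps s) :
    AntipodalVector φ := by
  refine ⟨(mem_affineDeps.1 hφ).1, fun i j hij => ?_⟩
  have key : ∀ i j, i ≠ j → (φ j - φ i) + |φ i| + |φ j| ≤ ∑ k, |φ k| := by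
    intro i j hij
    obtain ⟨f, hf, hall⟩ := h (s i) ⟨i, rfl⟩ (s j) ⟨j, rfl⟩ (hs.ne hij)
    set d := f (s j) - f (s i) with hd
    have hd0 : 0 < d := by linarith
    set m := -(f (s i) + f (s j)) / 2 with hm
    have h0 := sum_mul_eq_zero_of_mem_affineDeps hφ f m
    have hterm : ∀ k, |φ k * (f (s k) + m)| ≤ |φ k| * (d / 2) := by
      intro k
      rw [abs_mul]
      refine mul_le_mul_of_nonneg_left ?_ (abs_nonneg _)
      obtain ⟨h1, h2⟩ := hall (s k) ⟨k, rfl⟩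
      rw [abs_le]; constructor <;> linarith
    have hsum : ∑ k, (φ k * (f (s k) + m) + |φ k| * (d / 2))
        = (∑ k, |φ k|) * (d / 2) := by
      rw [Finset.sum_add_distrib, h0, zero_add, Finset.sum_mul]
    have hle : (φ i * (f (s i) + m) + |φ i| * (d / 2)) + (φ j * (f (s j) + m) + |φ j| * (d / 2))
        ≤ ∑ k, (φ k * (f (s k) + m) + |φ k| * (d / 2)) := by
      rw [← Finset.sum_pair (f := fun k => φ k * (f (s k) + m) + |φ k| * (d / 2)) hij]
      refine Finset.sum_le_sum_of_subset_of_nonneg (Finset.subset_univ _) fun k _ _ => ?_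
      have := neg_le_of_abs_le (hterm k)
      linarith
    rw [hsum, show f (s i) + m = -(d / 2) by rw [hm, hd]; ring,
      show f (s j) + m = d / 2 by rw [hm, hd]; ring] at hle
    have : ((φ j - φ i) + |φ i| + |φ j|) * (d / 2) ≤ (∑ k, |φ k|) * (d / 2) := by linarith
    exact le_of_mul_le_mul_right this (by positivity)
  rcases abs_cases (φ i - φ j) with ⟨e, -⟩ | ⟨e, -⟩ <;> rw [e]
  · linarith [key j i hij.symm]
  · linarith [key i j hij]

theorem finrank_affineDeps {s : Fin 6 → Space3} (hs : Function.Injective s)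
    (h : IsAntipodal (Set.range s)) : Module.finrank ℝ (affineDeps s) = 2 := by
  refine le_antisymm (finrank_le_two_of_antipodalVector
    fun φ hφ => antipodalVector_of_mem_affineDeps hs h hφ) ?_
  have h1 := LinearMap.finrank_range_add_finrank_ker
    (Fintype.linearCombination ℝ fun i => ((1 : ℝ), s i))
  have h2 := Submodule.finrank_le
    (LinearMap.range (Fintype.linearCombination ℝ fun i => ((1 : ℝ), s i)))
  simp only [Module.finrank_prod, Module.finrank_self, finrank_euclideanSpace, Fintype.card_fin,
    Module.finrank_fintype_fun_eq_card] at h1 h2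
  rw [affineDeps]
  omega

/-- A vector that is orthogonal to all affine dependences consists of the values of an affine
function. -/
theorem exists_affine_of_forall_mem_affineDeps {s : Fin 6 → Space3} {v : Fin 6 → ℝ}
    (hv : ∀ φ ∈ affineDeps s, ∑ k, φ k * v k = 0) :
    ∃ (l : Space3 →L[ℝ] ℝ) (c : ℝ), ∀ k, v k = l (s k) + c := by
  set M := Fintype.linearCombination ℝ fun i => ((1 : ℝ), s i) with hM
  -- The annihilator of the kernel is the range of the dual map; a preimage `g` on `ℝ × Space3`
  -- splits into the constant and the linear part.
  have hmem : Fintype.linearCombination ℝ v ∈ (LinearMap.ker M).dualAnnihilator := by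
    rw [Submodule.mem_dualAnnihilator]
    intro φ hφ
    simpa [Fintype.linearCombination_apply] using hv φ hφ
  rw [← LinearMap.range_dualMap_eq_dualAnnihilator_ker] at hmem
  obtain ⟨g, hg⟩ := hmem
  refine ⟨LinearMap.toContinuousLinearMap (g.comp (LinearMap.inr ℝ ℝ Space3)), g (1, 0),
    fun k => ?_⟩
  have := LinearMap.congr_fun hg (Pi.single k 1)
  simp only [LinearMap.dualMap_apply, hM, Fintype.linearCombination_apply_single, one_smul] at this
  rw [← this]
  simp [← map_add]

theorem exists_combination_of_mem_affineDeps {s : Fin 6 → Space3} (hs : Function.Injective s)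
    (h : IsAntipodal (Set.range s)) {p q : Fin 6 → ℝ} (hp : p ∈ affineDeps s)
    (hq : q ∈ affineDeps s) {i j : Fin 6} (hij : bracket p q i j ≠ 0) {φ : Fin 6 → ℝ}
    (hφ : φ ∈ affineDeps s) : ∃ x y : ℝ, ∀ k, φ k = x * p k + y * q k := by
  have hli : LinearIndependent ℝ ![(⟨p, hp⟩ : affineDeps s), ⟨q, hq⟩] := by
    rw [LinearIndependent.pair_iff]
    intro x y hxy
    have hx : ∀ k, x * p k + y * q k = 0 := fun k => congrFun (congrArg Subtype.val hxy) k
    have hi := hx i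
    have hj := hx j
    constructor
    · refine (mul_eq_zero.1 (?_ : x * bracket p q i j = 0)).resolve_right hij
      simp only [bracket]; linear_combination q j * hi - q i * hj
    · refine (mul_eq_zero.1 (?_ : y * bracket p q i j = 0)).resolve_right hij
      simp only [bracket]; linear_combination p i * hj - p j * hi
  have hspan := hli.span_eq_top_of_card_eq_finrank (by rw [finrank_affineDeps hs h]; simp)
  have hmem : (⟨φ, hφ⟩ : affineDeps s) ∈ Submodule.span ℝ
      (Set.range ![(⟨p, hp⟩ : affineDeps s), ⟨q, hq⟩]) := hspan ▸ Submodule.mem_top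
  rw [Matrix.range_cons, Matrix.range_cons, Matrix.range_empty, Set.union_empty,
    Set.singleton_union, Submodule.mem_span_pair] at hmem
  obtain ⟨x, y, hxy⟩ := hmem
  exact ⟨x, y, fun k => (congrFun (congrArg Subtype.val hxy) k).symm⟩

theorem exists_affine_of_orthogonal {s : Fin 6 → Space3} (hs : Function.Injective s)
    (h : IsAntipodal (Set.range s)) {p q : Fin 6 → ℝ} (hp : p ∈ affineDeps s)
    (hq : q ∈ affineDeps s) {i j : Fin 6} (hij : bracket p q i j ≠ 0) {v : Fin 6 → ℝ}
    (hvp : ∑ k, p k * v k = 0) (hvq : ∑ k, q k * v k = 0) :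
    ∃ (l : Space3 →L[ℝ] ℝ) (c : ℝ), ∀ k, v k = l (s k) + c := by
  refine exists_affine_of_forall_mem_affineDeps fun φ hφ => ?_
  obtain ⟨x, y, hxy⟩ := exists_combination_of_mem_affineDeps hs h hp hq hij hφ
  simp only [hxy, add_mul, mul_assoc, Finset.sum_add_distrib, ← Finset.mul_sum, hvp, hvq]
  simp

/-! ### Faces as index sets -/

/-- The points `s i`, `i ∈ I`, are those at which some linear functional attains an upper bound. -/
def IsSupported (s : Fin 6 → Space3) (I : Finset (Fin 6)) : Prop :=
  ∃ (l : Space3 →L[ℝ] ℝ) (c : ℝ), ∀ i, l (s i) ≤ c ∧ (l (s i) = c ↔ i ∈ I)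

theorem IsSupported.inter {s : Fin 6 → Space3} {I J : Finset (Fin 6)} (hI : IsSupported s I)
    (hJ : IsSupported s J) : IsSupported s (I ∩ J) := by
  obtain ⟨l, c, h⟩ := hI
  obtain ⟨l', c', h'⟩ := hJ
  refine ⟨l + l', c + c', fun i => ⟨add_le_add (h i).1 (h' i).1, ?_⟩⟩
  rw [Finset.mem_inter, ← (h i).2, ← (h' i).2, add_apply,
    add_eq_add_iff_eq_and_eq (h i).1 (h' i).1]

theorem isSupported_univ (s : Fin 6 → Space3) : IsSupported s Finset.univ :=
  ⟨0, 0, by simp⟩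

theorem isSupported_empty (s : Fin 6 → Space3) : IsSupported s ∅ :=
  ⟨0, 1, by simp⟩

theorem le_of_mem_convexHull {T : Set Space3} {l : Space3 →L[ℝ] ℝ} {c : ℝ}
    (h : ∀ x ∈ T, l x ≤ c) {x : Space3} (hx : x ∈ convexHull ℝ T) : l x ≤ c :=
  convexHull_min (t := {x | l x ≤ c}) h (convex_halfSpace_le l.isLinear c) hx

theorem eq_of_mem_convexHull {T : Set Space3} {l : Space3 →L[ℝ] ℝ} {c : ℝ}
    (h : ∀ x ∈ T, l x = c) {x : Space3} (hx : x ∈ convexHull ℝ T) : l x = c :=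
  convexHull_min (t := {x | l x = c}) h (convex_hyperplane l.isLinear c) hx

/-- In a convex combination that attains the maximal value, points with a smaller value carry weight
zero. -/
theorem mem_convexHull_of_apply_eq {T : Set Space3} {l : Space3 →L[ℝ] ℝ} {c : ℝ}
    (h : ∀ x ∈ T, l x ≤ c) {x : Space3} (hx : x ∈ convexHull ℝ T) (hc : l x = c) :
    x ∈ convexHull ℝ {y ∈ T | l y = c} := by
  obtain ⟨ι, _, w, z, hw, hw1, hz, rfl⟩ := mem_convexHull_iff_exists_fintype.1 hx
  have hsum : ∑ i, w i * (c - l (z i)) = 0 := by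
    simp only [mul_sub, Finset.sum_sub_distrib, ← Finset.sum_mul, hw1, one_mul]
    rw [← hc, map_sum]
    simp
  have hzero := (Finset.sum_eq_zero_iff_of_nonneg fun i _ =>
    mul_nonneg (hw i) (sub_nonneg.2 (h _ (hz i)))).1 hsum
  rw [← Finset.sum_filter_of_ne (p := fun i => w i ≠ 0)
    (fun i _ hi h0 => hi (by rw [h0, zero_smul]))]
  refine (convex_convexHull ℝ _).sum_mem (fun i _ => hw i) ?_ fun i hi => ?_
  · rw [Finset.sum_filter_ne_zero, hw1]
  · refine subset_convexHull ℝ _ ⟨hz i, ?_⟩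
    have := (mul_eq_zero.1 (hzero i (Finset.mem_univ _))).resolve_left (Finset.mem_filter.1 hi).2
    linarith

theorem IsSupported.apply_mem_convexHull {s : Fin 6 → Space3} {I : Finset (Fin 6)}
    (h : IsSupported s I) (i : Fin 6) : s i ∈ convexHull ℝ (s '' I) ↔ i ∈ I := by
  obtain ⟨l, c, h⟩ := h
  refine ⟨fun hi => (h i).2.1 ?_, fun hi => subset_convexHull ℝ _ ⟨i, hi, rfl⟩⟩
  refine eq_of_mem_convexHull ?_ hi
  rintro _ ⟨j, hj, rfl⟩
  exact (h j).2.2 hj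

theorem IsSupported.isFace {s : Fin 6 → Space3} {I : Finset (Fin 6)} (h : IsSupported s I) :
    IsFace (convexHull ℝ (Set.range s)) (convexHull ℝ (s '' I)) := by
  rintro hne
  obtain ⟨_, i, hi, rfl⟩ := convexHull_nonempty_iff.1 hne
  obtain ⟨l, c, h⟩ := h
  have hle : ∀ x ∈ Set.range s, l x ≤ c := by rintro _ ⟨j, rfl⟩; exact (h j).1
  refine ⟨l, Set.Subset.antisymm (fun x hx => ⟨convexHull_mono (Set.image_subset_range _ _) hx,
    fun y hy => ?_⟩) fun x hx => ?_⟩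
  · rw [eq_of_mem_convexHull (c := c) (l := l) _ hx]
    · exact le_of_mem_convexHull hle hy
    · rintro _ ⟨j, hj, rfl⟩
      exact (h j).2.2 hj
  · have hxc : l x = c := le_antisymm (le_of_mem_convexHull hle hx.1)
      (((h i).2.2 hi).symm.le.trans (hx.2 _ (subset_convexHull ℝ _ ⟨i, rfl⟩)))
    refine convexHull_mono ?_ (mem_convexHull_of_apply_eq hle hx.1 hxc)
    rintro _ ⟨⟨j, rfl⟩, hj⟩
    exact ⟨j, (h j).2.1 hj, rfl⟩

-- A face is recovered from the points it contains, since an exposed face is the hull of the points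
-- where its functional is maximal.
open Classical in
theorem IsFace.isSupported {s : Fin 6 → Space3} {F : Set Space3}
    (h : IsFace (convexHull ℝ (Set.range s)) F) :
    IsSupported s {i | s i ∈ F} ∧
      convexHull ℝ (s '' (({i | s i ∈ F} : Finset (Fin 6)) : Set (Fin 6))) = F := by
  rcases F.eq_empty_or_nonempty with rfl | hne
  · simpa using isSupported_empty s
  · obtain ⟨l, hl⟩ := h hne
    obtain ⟨x, hx⟩ := hne
    have hx' := hx
    rw [hl] at hx'
    have hle : ∀ y ∈ Set.range s, l y ≤ l x := by
      rintro _ ⟨j, rfl⟩; exact hx'.2 _ (subset_convexHull ℝ _ ⟨j, rfl⟩)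
    have hF : ∀ y ∈ convexHull ℝ (Set.range s), y ∈ F ↔ l y = l x := by
      intro y hy
      rw [hl]
      exact ⟨fun h => le_antisymm (hx'.2 y hy) (h.2 x hx'.1),
        fun h => ⟨hy, fun z hz => h ▸ hx'.2 z hz⟩⟩
    have hs : ∀ i, s i ∈ F ↔ l (s i) = l x := fun i =>
      hF _ (subset_convexHull ℝ _ ⟨i, rfl⟩)
    have hsub : F ⊆ convexHull ℝ (Set.range s) := by
      rw [hl]; exact fun y hy => hy.1
    refine ⟨⟨l, l x, fun i => ⟨hle _ ⟨i, rfl⟩, by simp [hs]⟩⟩, Set.Subset.antisymm ?_ ?_⟩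
    · intro y hy
      refine (hF y (convexHull_mono (Set.image_subset_range _ _) hy)).2
        (eq_of_mem_convexHull ?_ hy)
      rintro _ ⟨j, hj, rfl⟩
      simpa [hs] using hj
    · intro y hy
      refine convexHull_mono ?_ (mem_convexHull_of_apply_eq hle (hsub hy) ((hF y (hsub hy)).1 hy))
      rintro _ ⟨⟨j, rfl⟩, hj⟩
      exact ⟨j, by simpa [hs] using hj, rfl⟩

open Classical in
/-- The face lattice of a polytope in terms of the index sets of the faces. -/
noncomputable def faceOrderIso (s : Fin 6 → Space3) :
    {F : Set Space3 // IsFace (convexHull ℝ (Set.range s)) F} ≃o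
      {I : Finset (Fin 6) // IsSupported s I} where
  toFun F := ⟨({i | s i ∈ F.1} : Finset (Fin 6)), F.2.isSupported.1⟩
  invFun I := ⟨convexHull ℝ (s '' I.1), I.2.isFace⟩
  left_inv F := Subtype.ext F.2.isSupported.2
  right_inv I := Subtype.ext (by ext i; simp [I.2.apply_mem_convexHull i])
  map_rel_iff' {F G} := by
    constructor
    · intro h
      change F.1 ⊆ G.1
      rw [← F.2.isSupported.2, ← G.2.isSupported.2]
      exact convexHull_mono (Set.image_mono (Finset.coe_subset.2 h))
    · intro h i hi
      have h' : F.1 ⊆ G.1 := h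
      simp only [Equiv.coe_fn_mk, Finset.mem_filter, Finset.mem_univ, true_and] at hi ⊢
      exact h' hi

theorem combinatoriallyEquivalent_of_isSupported_iff {s t : Fin 6 → Space3}
    (h : ∀ I, IsSupported s I ↔ IsSupported t I) :
    CombinatoriallyEquivalent (convexHull ℝ (Set.range s)) (convexHull ℝ (Set.range t)) :=
  ⟨((faceOrderIso s).trans ⟨Equiv.subtypeEquivRight h, Iff.rfl⟩).trans (faceOrderIso t).symm⟩

theorem CombinatoriallyEquivalent.natCard_eq {s t : Fin 6 → Space3}
    (h : CombinatoriallyEquivalent (convexHull ℝ (Set.range s)) (convexHull ℝ (Set.range t))) :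
    Nat.card {I // IsSupported s I} = Nat.card {I // IsSupported t I} := by
  obtain ⟨e⟩ := h
  exact Nat.card_congr (((faceOrderIso s).symm.trans e).trans (faceOrderIso t)).toEquiv

/-- `I` is empty or an intersection of members of `K`. -/
def IsIntersection (K : Finset (Finset (Fin 6))) (I : Finset (Fin 6)) : Prop :=
  I = ∅ ∨ (K.filter (I ⊆ ·)).inf id = I

instance (K : Finset (Finset (Fin 6))) (I : Finset (Fin 6)) : Decidable (IsIntersection K I) := by
  unfold IsIntersection; infer_instance

/-- The faces are determined by the facets, provided that sufficiently many implications between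
the incidences are known. -/
theorem isSupported_iff_isIntersection {s : Fin 6 → Space3} {K : Finset (Finset (Fin 6))}
    {R : Finset (Fin 6) → Prop} (hK : ∀ F ∈ K, IsSupported s F)
    (hR : ∀ I, IsSupported s I → R I) (hRK : ∀ I, R I → IsIntersection K I)
    (I : Finset (Fin 6)) : IsSupported s I ↔ IsIntersection K I := by
  refine ⟨fun h => hRK I (hR I h), fun h => ?_⟩
  rcases h with rfl | h
  · exact isSupported_empty s
  · rw [← h]
    exact Finset.inf_induction (isSupported_univ s) (fun _ h₁ _ h₂ => h₁.inter h₂)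
      fun F hF => hK F (Finset.mem_filter.1 hF).1

/-- An affine dependence forces incidences of points with faces. -/
theorem IsSupported.subset_of_mem_affineDeps {s : Fin 6 → Space3} {φ : Fin 6 → ℝ}
    (hφ : φ ∈ affineDeps s) {A B : Finset (Fin 6)} (hA : ∀ i ∉ A, φ i ≤ 0)
    (hB : ∀ i ∈ B, φ i < 0) {I : Finset (Fin 6)} (hI : IsSupported s I) (hAI : A ⊆ I) : B ⊆ I := by
  obtain ⟨l, c, h⟩ := hI
  have h0 := sum_mul_eq_zero_of_mem_affineDeps hφ l (-c)
  have hnn : ∀ i ∈ Finset.univ, 0 ≤ φ i * (l (s i) + -c) := by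
    intro i _
    by_cases hi : i ∈ A
    · rw [(h i).2.2 (hAI hi)]; simp
    · exact mul_nonneg_of_nonpos_of_nonpos (hA i hi) (by linarith [(h i).1])
  intro i hi
  have := (Finset.sum_eq_zero_iff_of_nonneg hnn).1 h0 i (Finset.mem_univ _)
  have := (mul_eq_zero.1 this).resolve_left (hB i hi).ne
  exact (h i).2.1 (by linarith)

/-- A nonnegative vector that is orthogonal to the affine dependences is the vector of distances
from a supporting plane. -/
theorem isSupported_of_orthogonal {s : Fin 6 → Space3} (hs : Function.Injective s)
    (h : IsAntipodal (Set.range s)) {p q : Fin 6 → ℝ} (hp : p ∈ affineDeps s)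
    (hq : q ∈ affineDeps s) {i j : Fin 6} (hij : bracket p q i j ≠ 0) (v : Fin 6 → ℝ)
    (hvp : ∑ k, p k * v k = 0) (hvq : ∑ k, q k * v k = 0) {I : Finset (Fin 6)}
    (hv : ∀ k, 0 ≤ v k ∧ (v k = 0 ↔ k ∈ I)) : IsSupported s I := by
  obtain ⟨l, c, hl⟩ := exists_affine_of_orthogonal hs h hp hq hij hvp hvq
  refine ⟨-l, c, fun k => ?_⟩
  rw [← (hv k).2]
  have h1 := (hv k).1
  rw [hl k] at h1 ⊢
  rw [neg_apply]
  exact ⟨by linarith, by constructor <;> intro <;> linarith⟩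

/-! ### Face lattices of the three types -/

/-- The opposite pairs are `01`, `23`, `45`; a facet contains one vertex of each. -/
def octahedronFacets : Finset (Finset (Fin 6)) :=
  {{0, 2, 4}, {0, 2, 5}, {0, 3, 4}, {0, 3, 5}, {1, 2, 4}, {1, 2, 5}, {1, 3, 4}, {1, 3, 5}}

def prismFacets : Finset (Finset (Fin 6)) :=
  {{0, 1, 2, 3}, {0, 1, 4, 5}, {2, 3, 4, 5}, {0, 3, 4}, {1, 2, 5}}

def skewPrismFacets : Finset (Finset (Fin 6)) :=
  {{0, 1, 2, 3}, {0, 3, 4}, {1, 2, 5}, {0, 1, 4}, {2, 3, 5}, {1, 4, 5}, {3, 4, 5}}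

/-- Here `28 = 1 + 6 + 12 + 8 + 1`, counting the empty face and the whole polytope. The counts below
are `22 = 1 + 6 + 9 + 5 + 1` and `26 = 1 + 6 + 11 + 7 + 1`. -/
theorem card_octahedronFacets_faces :
    Fintype.card {I // IsIntersection octahedronFacets I} = 28 := by decide +kernel

theorem card_prismFacets_faces :
    Fintype.card {I // IsIntersection prismFacets I} = 22 := by decide +kernel

theorem card_skewPrismFacets_faces :
    Fintype.card {I // IsIntersection skewPrismFacets I} = 26 := by decide +kernel

-- The four implications chain together: a set containing one opposite pair contains all of them, so
-- a proper face contains at most one vertex of each pair.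
set_option maxRecDepth 10000 in
theorem isIntersection_octahedronFacets : ∀ I : Finset (Fin 6),
    (({4, 5} ⊆ I → {2, 3} ⊆ I) ∧ ({2, 3} ⊆ I → {4, 5} ⊆ I) ∧ ({0, 1} ⊆ I → {4, 5} ⊆ I) ∧
      ({4, 5} ⊆ I → {0, 1} ⊆ I)) → IsIntersection octahedronFacets I := by
  decide +kernel

set_option maxRecDepth 10000 in
theorem isIntersection_prismFacets : ∀ I : Finset (Fin 6),
    (({0, 2} ⊆ I → {1, 3} ⊆ I) ∧ ({1, 3} ⊆ I → {0, 2} ⊆ I) ∧ ({3, 5} ⊆ I → {2, 4} ⊆ I) ∧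
      ({2, 4} ⊆ I → {3, 5} ⊆ I) ∧ ({0, 5} ⊆ I → {1, 4} ⊆ I) ∧ ({1, 4} ⊆ I → {0, 5} ⊆ I)) →
      IsIntersection prismFacets I := by
  decide +kernel

set_option maxRecDepth 10000 in
theorem isIntersection_skewPrismFacets : ∀ I : Finset (Fin 6),
    (({0, 2} ⊆ I → {1, 3} ⊆ I) ∧ ({1, 3} ⊆ I → {0, 2} ⊆ I) ∧ ({2, 4} ⊆ I → {1, 3, 5} ⊆ I) ∧
      ({0, 5} ⊆ I → {1, 3, 4} ⊆ I)) → IsIntersection skewPrismFacets I := by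
  decide +kernel

theorem bracket_mem_affineDeps {s : Fin 6 → Space3} {p q : Fin 6 → ℝ} (hp : p ∈ affineDeps s)
    (hq : q ∈ affineDeps s) (i : Fin 6) : bracket p q i ∈ affineDeps s := by
  have := (affineDeps s).sub_mem ((affineDeps s).smul_mem (p i) hq)
    ((affineDeps s).smul_mem (q i) hp)
  convert this using 1
  funext k
  simp only [bracket, Pi.sub_apply, Pi.smul_apply, smul_eq_mul]; ring

theorem bracket_mem_affineDeps' {s : Fin 6 → Space3} {p q : Fin 6 → ℝ} (hp : p ∈ affineDeps s)
    (hq : q ∈ affineDeps s) (i : Fin 6) : (fun k => bracket p q k i) ∈ affineDeps s := by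
  have := (affineDeps s).neg_mem (bracket_mem_affineDeps hp hq i)
  convert this using 1
  funext k
  exact bracket_swap p q i k

/-- Three Gale vectors that contain the origin in the interior of their convex hull are the coface
of a triangle. -/
theorem isSupported_compl_of_bracket_pos {s : Fin 6 → Space3} (hs : Function.Injective s)
    (h : IsAntipodal (Set.range s)) {p q : Fin 6 → ℝ} (hp : p ∈ affineDeps s)
    (hq : q ∈ affineDeps s) {i j k : Fin 6} (hij : 0 < bracket p q i j)
    (hjk : 0 < bracket p q j k) (hki : 0 < bracket p q k i) :
    IsSupported s ({i, j, k}ᶜ : Finset (Fin 6)) := by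
  have nij : i ≠ j := by rintro rfl; simp [bracket_self] at hij
  have njk : j ≠ k := by rintro rfl; simp [bracket_self] at hjk
  have nki : k ≠ i := by rintro rfl; simp [bracket_self] at hki
  -- The distances are the coefficients of the relation `[jk] g i + [ki] g j + [ij] g k = 0`.
  refine isSupported_of_orthogonal hs h hp hq hij.ne'
    (Pi.single i (bracket p q j k) + Pi.single j (bracket p q k i) + Pi.single k (bracket p q i j))
    ?_ ?_ fun m => ?_
  · simp only [Pi.add_apply, mul_add, Finset.sum_add_distrib, Pi.single_apply, mul_ite, mul_zero,
      Finset.sum_ite_eq', Finset.mem_univ, if_true, bracket]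
    ring
  · simp only [Pi.add_apply, mul_add, Finset.sum_add_distrib, Pi.single_apply, mul_ite, mul_zero,
      Finset.sum_ite_eq', Finset.mem_univ, if_true, bracket]
    ring
  · by_cases hi : m = i
    · subst hi; simp [nij, nki.symm, hjk.le, hjk.ne']
    by_cases hj : m = j
    · subst hj; simp [nij.symm, njk, hki.le, hki.ne']
    by_cases hk : m = k
    · subst hk; simp [njk.symm, nki, hij.le, hij.ne']
    simp [hi, hj, hk]

theorem isSupported_iff_of_isOctahedralGale {s : Fin 6 → Space3} (hs : Function.Injective s)
    (h : IsAntipodal (Set.range s)) {p q : Fin 6 → ℝ} (hp : p ∈ affineDeps s)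
    (hq : q ∈ affineDeps s) (ho : IsOctahedralGale p q) (I : Finset (Fin 6)) :
    IsSupported s I ↔ IsIntersection octahedronFacets I := by
  obtain ⟨-, -, h01, h23, h45, h02, h03, h12, h13, h24, h25, h34, h35, h40, h41, h50, h51⟩ := ho
  refine isSupported_iff_isIntersection ?_ ?_ isIntersection_octahedronFacets I
  · simp only [octahedronFacets, Finset.mem_insert, Finset.mem_singleton]
    rintro F (rfl | rfl | rfl | rfl | rfl | rfl | rfl | rfl)
    · exact isSupported_compl_of_bracket_pos hs h hp hq h13 h35 h51
    · exact isSupported_compl_of_bracket_pos hs h hp hq h13 h34 h41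
    · exact isSupported_compl_of_bracket_pos hs h hp hq h12 h25 h51
    · exact isSupported_compl_of_bracket_pos hs h hp hq h12 h24 h41
    · exact isSupported_compl_of_bracket_pos hs h hp hq h03 h35 h50
    · exact isSupported_compl_of_bracket_pos hs h hp hq h03 h34 h40
    · exact isSupported_compl_of_bracket_pos hs h hp hq h02 h25 h50
    · exact isSupported_compl_of_bracket_pos hs h hp hq h02 h24 h40
  · have s10 := bracket_swap p q 0 1
    have s20 := bracket_swap p q 0 2
    have s30 := bracket_swap p q 0 3
    have s41 := bracket_swap p q 4 1
    have s51 := bracket_swap p q 5 1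
    have s32 := bracket_swap p q 2 3
    have s42 := bracket_swap p q 2 4
    have s52 := bracket_swap p q 2 5
    have s31 := bracket_swap p q 1 3
    have d := bracket_self p q
    intro I hI
    refine ⟨?_, ?_, ?_, ?_⟩
    · refine hI.subset_of_mem_affineDeps (bracket_mem_affineDeps' hp hq 0)
        (forall_fin_six.2 ?_) (forall_fin_six.2 ?_) <;>
      refine ⟨?_, ?_, ?_, ?_, ?_, ?_⟩ <;> intro hi <;>
        first | exact absurd (by decide) hi | exact absurd hi (by decide) | linarith [d 0]
    · refine hI.subset_of_mem_affineDeps (bracket_mem_affineDeps hp hq 1)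
        (forall_fin_six.2 ?_) (forall_fin_six.2 ?_) <;>
      refine ⟨?_, ?_, ?_, ?_, ?_, ?_⟩ <;> intro hi <;>
        first | exact absurd (by decide) hi | exact absurd hi (by decide) | linarith [d 1]
    · refine hI.subset_of_mem_affineDeps (bracket_mem_affineDeps' hp hq 2)
        (forall_fin_six.2 ?_) (forall_fin_six.2 ?_) <;>
      refine ⟨?_, ?_, ?_, ?_, ?_, ?_⟩ <;> intro hi <;>
        first | exact absurd (by decide) hi | exact absurd hi (by decide) | linarith [d 2]
    · refine hI.subset_of_mem_affineDeps (bracket_mem_affineDeps hp hq 3)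
        (forall_fin_six.2 ?_) (forall_fin_six.2 ?_) <;>
      refine ⟨?_, ?_, ?_, ?_, ?_, ?_⟩ <;> intro hi <;>
        first | exact absurd (by decide) hi | exact absurd hi (by decide) | linarith [d 3]

theorem bracket_prism_ne_zero (α : ℝ) :
    bracket parallelogramDep (topEdgeDep α) 0 4 ≠ 0 := by
  simp [bracket, parallelogramDep, topEdgeDep]

theorem isSupported_of_prism {s : Fin 6 → Space3} (hs : Function.Injective s)
    (h : IsAntipodal (Set.range s)) {α : ℝ} (hp : parallelogramDep ∈ affineDeps s)
    (hq : topEdgeDep α ∈ affineDeps s) (v : Fin 6 → ℝ) (h1 : v 0 - v 1 + v 2 - v 3 = 0)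
    (h2 : (1 - α) * v 0 - v 2 + α * v 3 - v 4 + v 5 = 0) {I : Finset (Fin 6)}
    (hv : ∀ k, 0 ≤ v k ∧ (v k = 0 ↔ k ∈ I)) : IsSupported s I := by
  refine isSupported_of_orthogonal hs h hp hq (bracket_prism_ne_zero α) v ?_ ?_ hv
  · simp [Fin.sum_univ_six, parallelogramDep]; linarith
  · simp [Fin.sum_univ_six, topEdgeDep]; linarith

theorem subset_of_parallelogramDep {s : Fin 6 → Space3}
    (hp : parallelogramDep ∈ affineDeps s) {I : Finset (Fin 6)} (hI : IsSupported s I) :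
    ({0, 2} ⊆ I → {1, 3} ⊆ I) ∧ ({1, 3} ⊆ I → {0, 2} ⊆ I) := by
  constructor
  · exact hI.subset_of_mem_affineDeps hp
      (forall_fin_six.2 (by simp [parallelogramDep])) (forall_fin_six.2 (by simp [parallelogramDep]))
  · exact hI.subset_of_mem_affineDeps ((affineDeps s).neg_mem hp)
      (forall_fin_six.2 (by simp [parallelogramDep])) (forall_fin_six.2 (by simp [parallelogramDep]))

theorem isSupported_iff_of_prism {s : Fin 6 → Space3} (hs : Function.Injective s)
    (h : IsAntipodal (Set.range s)) (hp : parallelogramDep ∈ affineDeps s)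
    (hq : topEdgeDep 1 ∈ affineDeps s) (I : Finset (Fin 6)) :
    IsSupported s I ↔ IsIntersection prismFacets I := by
  refine isSupported_iff_isIntersection ?_ ?_ isIntersection_prismFacets I
  · simp only [prismFacets, Finset.mem_insert, Finset.mem_singleton]
    rintro F (rfl | rfl | rfl | rfl | rfl)
    · refine isSupported_of_prism hs h hp hq ![0, 0, 0, 0, 1, 1] ?_ ?_ (forall_fin_six.2 ?_) <;>
        simp
    · refine isSupported_of_prism hs h hp hq ![0, 0, 1, 1, 0, 0] ?_ ?_ (forall_fin_six.2 ?_) <;>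
        simp
    · refine isSupported_of_prism hs h hp hq ![1, 1, 0, 0, 0, 0] ?_ ?_ (forall_fin_six.2 ?_) <;>
        simp
    · refine isSupported_of_prism hs h hp hq ![0, 1, 1, 0, 0, 1] ?_ ?_ (forall_fin_six.2 ?_) <;>
        simp
    · refine isSupported_of_prism hs h hp hq ![1, 0, 0, 1, 1, 0] ?_ ?_ (forall_fin_six.2 ?_) <;>
        simp
  -- For `α = 1` the dependences `hp`, `hq`, `hq'` are those of the three parallelogram facets, and
  -- each diagonal forces the other.
  · have hq' := (affineDeps s).add_mem hq hp
    intro I hI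
    refine ⟨?_, ?_, ?_, ?_, ?_, ?_⟩
    · exact (subset_of_parallelogramDep hp hI).1
    · exact (subset_of_parallelogramDep hp hI).2
    · exact hI.subset_of_mem_affineDeps hq
        (forall_fin_six.2 (by simp [topEdgeDep])) (forall_fin_six.2 (by simp [topEdgeDep]))
    · exact hI.subset_of_mem_affineDeps ((affineDeps s).neg_mem hq)
        (forall_fin_six.2 (by simp [topEdgeDep])) (forall_fin_six.2 (by simp [topEdgeDep]))
    · exact hI.subset_of_mem_affineDeps hq'
        (forall_fin_six.2 (by simp [topEdgeDep, parallelogramDep]))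
        (forall_fin_six.2 (by simp [topEdgeDep, parallelogramDep]))
    · exact hI.subset_of_mem_affineDeps ((affineDeps s).neg_mem hq')
        (forall_fin_six.2 (by simp [topEdgeDep, parallelogramDep]))
        (forall_fin_six.2 (by simp [topEdgeDep, parallelogramDep]))

theorem isSupported_iff_of_skewPrism {s : Fin 6 → Space3} (hs : Function.Injective s)
    (h : IsAntipodal (Set.range s)) {α : ℝ} (hα0 : 0 ≤ α) (hα1 : α < 1)
    (hp : parallelogramDep ∈ affineDeps s)
    (hq : topEdgeDep α ∈ affineDeps s) (I : Finset (Fin 6)) :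
    IsSupported s I ↔ IsIntersection skewPrismFacets I := by
  have e1 : 0 < 1 - α := by linarith
  have e2 : 0 < 2 - α := by linarith
  refine isSupported_iff_isIntersection ?_ ?_ isIntersection_skewPrismFacets I
  · simp only [skewPrismFacets, Finset.mem_insert, Finset.mem_singleton]
    rintro F (rfl | rfl | rfl | rfl | rfl | rfl | rfl)
    -- Each vector lists distances from a facet plane. At `α = 1` further entries would vanish, and
    -- the last four triangles would merge in pairs into two quadrilaterals.
    · refine isSupported_of_prism hs h hp hq ![0, 0, 0, 0, 1, 1] ?_ ?_ (forall_fin_six.2 ?_) <;>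
        simp
    · refine isSupported_of_prism hs h hp hq ![0, 1, 1, 0, 0, 1] ?_ ?_ (forall_fin_six.2 ?_) <;>
        simp
    · refine isSupported_of_prism hs h hp hq ![1, 0, 0, 1, 1, 0] ?_ ?_ (forall_fin_six.2 ?_) <;>
        simp
    · refine isSupported_of_prism hs h hp hq ![0, 0, 1, 1, 0, 1 - α] ?_ ?_
        (forall_fin_six.2 ?_) <;> simp [e1.ne', hα1.le]
    · refine isSupported_of_prism hs h hp hq ![1, 1, 0, 0, 1 - α, 0] ?_ ?_
        (forall_fin_six.2 ?_) <;> simp [e1.ne', hα1.le]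
    · refine isSupported_of_prism hs h hp hq ![1 - α, 0, 1, 2 - α, 0, 0] ?_ ?_
        (forall_fin_six.2 ?_)
      · simp; ring
      · simp; ring
      · simp [e1.ne', e2.ne', e2.le, hα1.le]
    · refine isSupported_of_prism hs h hp hq ![1, 2 - α, 1 - α, 0, 0, 0] ?_ ?_
        (forall_fin_six.2 ?_)
      · simp; ring
      · simp
      · simp [e1.ne', e2.ne', hα1.le]; linarith
  -- These combinations cancel the entry at `0` and the entry at `2`, respectively; strict
  -- negativity of the entries at `1` and `3` uses `α < 1`.
  · have hq1 := (affineDeps s).sub_mem ((affineDeps s).smul_mem (1 - α) hp) hq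
    have hq2 := (affineDeps s).add_mem hq hp
    intro I hI
    refine ⟨?_, ?_, ?_, ?_⟩
    · exact (subset_of_parallelogramDep hp hI).1
    · exact (subset_of_parallelogramDep hp hI).2
    · refine hI.subset_of_mem_affineDeps hq1
        (forall_fin_six.2 ?_) (forall_fin_six.2 ?_) <;>
      simp [topEdgeDep, parallelogramDep] <;> linarith
    · refine hI.subset_of_mem_affineDeps hq2
        (forall_fin_six.2 ?_) (forall_fin_six.2 ?_) <;>
      simp [topEdgeDep, parallelogramDep] <;> linarith

/-! ### Planes, facets and differences -/

theorem affineIndependent_of_antipodal {s : Fin 6 → Space3} (hs : Function.Injective s)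
    (h : IsAntipodal (Set.range s)) {i j k : Fin 6} (hij : i ≠ j) (hik : i ≠ k) (hjk : j ≠ k) :
    AffineIndependent ℝ ![s i, s j, s k] := by
  rw [affineIndependent_iff_of_fintype]
  intro w hw hw'
  rw [Finset.univ.weightedVSub_eq_linear_combination hw] at hw'
  rw [Fin.sum_univ_three] at hw hw'
  simp only [Matrix.cons_val_zero, Matrix.cons_val_one, Matrix.cons_val] at hw'
  set φ : Fin 6 → ℝ := Pi.single i (w 0) + Pi.single j (w 1) + Pi.single k (w 2) with hφ
  have hmem : φ ∈ affineDeps s := by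
    rw [mem_affineDeps]
    simp only [hφ, Pi.add_apply, add_smul, Finset.sum_add_distrib, Pi.single_apply, ite_smul,
      zero_smul, Finset.sum_ite_eq', Finset.mem_univ, if_true]
    exact ⟨hw, hw'⟩
  have hi : φ i = w 0 := by simp [hφ, hij, hik]
  have hj : φ j = w 1 := by simp [hφ, hij.symm, hjk]
  have hk : φ k = w 2 := by simp [hφ, hik.symm, hjk.symm]
  have hanti := antipodalVector_of_mem_affineDeps hs h hmem
  have hsum : ∑ m, |φ m| ≤ |w 0| + |w 1| + |w 2| := by
    have : ∀ m, |φ m| ≤ (Pi.single i |w 0| + Pi.single j |w 1| + Pi.single k |w 2| : Fin 6 → ℝ) m := by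
      intro m
      simp only [hφ, Pi.add_apply, Pi.single_apply]
      refine (abs_add_three _ _ _).trans (le_of_eq ?_)
      congr 1
      · congr 1 <;> split_ifs <;> simp
      · split_ifs <;> simp
    refine (Finset.sum_le_sum fun m _ => this m).trans (le_of_eq ?_)
    simp only [Pi.add_apply, Finset.sum_add_distrib, Pi.single_apply, Finset.sum_ite_eq',
      Finset.mem_univ, if_true]
  have k1 := hanti.2 i j hij
  have k2 := hanti.2 i k hik
  have k3 := hanti.2 j k hjk
  rw [hi, hj] at k1
  rw [hi, hk] at k2
  rw [hj, hk] at k3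
  -- Since `w 2 = -(w 0 + w 1)`, this says `w 0 * w 1 ≥ 0`. All pairwise products are nonnegative
  -- and the sum is zero, so all weights vanish.
  have m1 : (w 0 - w 1) ^ 2 ≤ (w 2) ^ 2 := sq_le_sq.2 (by linarith)
  have m2 : (w 0 - w 2) ^ 2 ≤ (w 1) ^ 2 := sq_le_sq.2 (by linarith)
  have m3 : (w 1 - w 2) ^ 2 ≤ (w 0) ^ 2 := sq_le_sq.2 (by linarith)
  have e2 : w 2 = -w 0 - w 1 := by linarith
  rw [e2] at m1 m2 m3
  have z0 : w 0 = 0 := by nlinarith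
  have z1 : w 1 = 0 := by rw [z0] at m1 m2 m3; nlinarith
  rw [z0, z1] at e2
  intro m
  fin_cases m
  · exact z0
  · exact z1
  · simpa using e2

theorem finrank_vectorSpan_triple {s : Fin 6 → Space3} (hs : Function.Injective s)
    (h : IsAntipodal (Set.range s)) {i j k : Fin 6} (hij : i ≠ j) (hik : i ≠ k) (hjk : j ≠ k) :
    Module.finrank ℝ (vectorSpan ℝ {s i, s j, s k}) = 2 := by
  have := (affineIndependent_of_antipodal hs h hij hik hjk).finrank_vectorSpan (n := 2) (by simp)
  rwa [Matrix.range_cons, Matrix.range_cons, Matrix.range_cons, Matrix.range_empty,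
    Set.union_empty, Set.singleton_union, Set.singleton_union] at this

theorem finrank_ker_of_ne {l : Space3 →L[ℝ] ℝ} {x y : Space3} (hxy : l x ≠ l y) :
    Module.finrank ℝ (LinearMap.ker (l : Space3 →ₗ[ℝ] ℝ)) = 2 := by
  have hl : (l : Space3 →ₗ[ℝ] ℝ) ≠ 0 := by
    intro h0
    have : ∀ z, l z = 0 := fun z => LinearMap.congr_fun h0 z
    exact hxy ((this x).trans (this y).symm)
  have := Module.Dual.finrank_ker_add_one_of_ne_zero hl
  rw [finrank_euclideanSpace, Fintype.card_fin] at this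
  omega

/-- The direction of the plane spanned by a set that contains three of the points and on which some
linear functional is constant. -/
theorem vectorSpan_eq_ker {s : Fin 6 → Space3} (hs : Function.Injective s)
    (h : IsAntipodal (Set.range s)) {i j k : Fin 6} (hij : i ≠ j) (hik : i ≠ k) (hjk : j ≠ k)
    {T : Set Space3} (hi : s i ∈ T) (hj : s j ∈ T) (hk : s k ∈ T) {l : Space3 →L[ℝ] ℝ}
    {x y : Space3} (hxy : l x ≠ l y) {c : ℝ} (hT : ∀ z ∈ T, l z = c) :
    vectorSpan ℝ T = LinearMap.ker (l : Space3 →ₗ[ℝ] ℝ) := by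
  have hle : vectorSpan ℝ T ≤ LinearMap.ker (l : Space3 →ₗ[ℝ] ℝ) := by
    refine Submodule.span_le.2 ?_
    rintro _ ⟨a, ha, b, hb, rfl⟩
    simp [hT a ha, hT b hb]
  have hsub : ({s i, s j, s k} : Set Space3) ⊆ T := by
    rintro _ (rfl | rfl | rfl) <;> assumption
  refine Submodule.eq_of_le_of_finrank_le hle ?_
  rw [finrank_ker_of_ne hxy, ← finrank_vectorSpan_triple hs h hij hik hjk]
  exact Submodule.finrank_mono (vectorSpan_mono ℝ hsub)

theorem vectorSpan_convexHull (T : Set Space3) :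
    vectorSpan ℝ (convexHull ℝ T) = vectorSpan ℝ T := by
  rw [← direction_affineSpan, affineSpan_convexHull, direction_affineSpan]

theorem finrank_vectorSpan_range {s : Fin 6 → Space3} (hs : Function.Injective s)
    (h : IsAntipodal (Set.range s)) {i j k m : Fin 6} (hij : i ≠ j) (hik : i ≠ k) (hjk : j ≠ k)
    {l : Space3 →L[ℝ] ℝ} {c : ℝ} (hi : l (s i) = c) (hj : l (s j) = c) (hk : l (s k) = c)
    (hm : l (s m) ≠ c) : Module.finrank ℝ (vectorSpan ℝ (Set.range s)) = 3 := by
  have hne : l (s m) ≠ l (s i) := by rwa [hi]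
  have hlt : LinearMap.ker (l : Space3 →ₗ[ℝ] ℝ) < vectorSpan ℝ (Set.range s) := by
    refine lt_of_le_of_ne ?_ fun he => ?_
    · rw [← vectorSpan_eq_ker hs h hij hik hjk (T := {s i, s j, s k}) (by simp) (by simp) (by simp)
        hne (c := c) (by rintro _ (rfl | rfl | rfl) <;> assumption)]
      refine vectorSpan_mono ℝ ?_
      rintro _ (rfl | rfl | rfl) <;> exact ⟨_, rfl⟩
    · have : s m -ᵥ s i ∈ vectorSpan ℝ (Set.range s) :=
        vsub_mem_vectorSpan ℝ ⟨m, rfl⟩ ⟨i, rfl⟩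
      rw [← he, LinearMap.mem_ker] at this
      refine hne (sub_eq_zero.1 ?_)
      simpa using this
  have h1 := Submodule.finrank_lt_finrank_of_lt hlt
  have h2 := Submodule.finrank_le (vectorSpan ℝ (Set.range s))
  rw [finrank_ker_of_ne hne] at h1
  rw [finrank_euclideanSpace, Fintype.card_fin] at h2
  omega

theorem parallel_of_vectorSpan_eq {T U : Set Space3} (hT : T.Nonempty) (hU : U.Nonempty)
    (h : vectorSpan ℝ T = vectorSpan ℝ U) : affineSpan ℝ T ∥ affineSpan ℝ U :=
  AffineSubspace.affineSpan_parallel_iff_vectorSpan_eq_and_eq_empty_iff_eq_empty.2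
    ⟨h, iff_of_false hT.ne_empty hU.ne_empty⟩

theorem apply_eq_of_mem_affineSpan {T : Set Space3} {l : Space3 →L[ℝ] ℝ} {c : ℝ}
    (h : ∀ x ∈ T, l x = c) {x : Space3} (hx : x ∈ affineSpan ℝ T) : l x = c := by
  have hle : affineSpan ℝ T ≤
      (AffineSubspace.mk' c ⊥).comap (l : Space3 →ₗ[ℝ] ℝ).toAffineMap := by
    rw [affineSpan_le]
    intro y hy
    simp [h y hy]
  simpa [sub_eq_zero] using hle hx

/-- In an antipodal set, a difference of two points is a boundary point of the convex hull of any
set of differences that contains the opposite difference. -/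
theorem IsAntipodal.differencesOnBoundary {S T₁ T₂ : Set Space3} (h : IsAntipodal S)
    (h₁ : T₁ ⊆ S) (h₂ : T₂ ⊆ S) : DifferencesOnBoundary T₁ T₂ := by
  have hS : ∀ q ∈ T₁.offDiag ∪ T₂.offDiag, q.1 ∈ S ∧ q.2 ∈ S ∧ q.1 ≠ q.2 := by
    rintro q (hq | hq)
    · exact ⟨h₁ hq.1, h₁ hq.2.1, hq.2.2⟩
    · exact ⟨h₂ hq.1, h₂ hq.2.1, hq.2.2⟩
  intro p hp hint
  obtain ⟨hp1, hp2, hpne⟩ := hS p hp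
  obtain ⟨f, hf, hall⟩ := h _ hp1 _ hp2 hpne
  set B := (fun q : Space3 × Space3 => q.1 - q.2) '' ((T₁.offDiag ∪ T₂.offDiag) \ {p}) with hB
  have hge : ∀ x ∈ convexHull ℝ B, f (p.1 - p.2) ≤ f x := by
    intro x hx
    have : ∀ y ∈ B, (-f) y ≤ -f (p.1 - p.2) := by
      rintro _ ⟨q, ⟨hq, -⟩, rfl⟩
      obtain ⟨hq1, hq2, -⟩ := hS q hq
      have a1 := hall _ hq1
      have a2 := hall _ hq2
      simp only [neg_apply, map_sub]
      linarith
    have := le_of_mem_convexHull this hx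
    rw [neg_apply] at this
    linarith
  -- The opposite difference survives the removal of `p` and has a strictly larger value of `f`.
  have hy : p.2 - p.1 ∈ convexHull ℝ B := by
    refine subset_convexHull ℝ B ⟨(p.2, p.1), ⟨?_, fun he => hpne ?_⟩, rfl⟩
    · rcases hp with hp | hp
      · exact Or.inl ⟨hp.2.1, hp.1, hp.2.2.symm⟩
      · exact Or.inr ⟨hp.2.1, hp.1, hp.2.2.symm⟩
    · exact (congrArg Prod.snd he : p.1 = p.2)
  obtain ⟨x, hx, hxp⟩ := mem_intrinsicInterior.1 hint
  let γ : ℝ → affineSpan ℝ (convexHull ℝ B) := fun t =>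
    ⟨AffineMap.lineMap (x : Space3) (p.2 - p.1) t,
      AffineMap.lineMap_mem t x.2 (subset_affineSpan ℝ _ hy)⟩
  have hγ : Continuous γ := by
    refine Continuous.subtype_mk ?_ _
    exact AffineMap.lineMap_continuous
  have hγ0 : γ 0 = x := Subtype.ext (by simp [γ])
  have hmem : ∀ᶠ t in nhds (0 : ℝ), γ t ∈ ((↑) ⁻¹' convexHull ℝ B : Set (affineSpan ℝ _)) := by
    refine (hγ.tendsto 0).eventually ?_
    rw [hγ0]
    exact mem_interior_iff_mem_nhds.1 hx
  obtain ⟨ε, hε, hball⟩ := Metric.eventually_nhds_iff.1 hmem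
  -- A negative parameter moves from `p.1 - p.2` away from the opposite difference. A relative
  -- interior point allows a small such move, but it would take `f` below its minimum.
  have h1 := hge _ (hball (y := -(ε / 2)) (by
    rw [Real.dist_eq, sub_zero, abs_neg, abs_of_pos (by positivity)]; linarith))
  simp only [γ, AffineMap.lineMap_apply, hxp, vsub_eq_sub, vadd_eq_add, map_add, map_smul, map_sub,
    smul_eq_mul] at h1
  nlinarith

/-- Two triples of points on which a linear functional takes two different values span parallel
planes. -/
theorem exists_parallel_planes {s : Fin 6 → Space3} (hs : Function.Injective s)
    (h : IsAntipodal (Set.range s)) {i₁ i₂ i₃ j₁ j₂ j₃ : Fin 6} (hi₁₂ : i₁ ≠ i₂) (hi₁₃ : i₁ ≠ i₃)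
    (hi₂₃ : i₂ ≠ i₃) (hj₁₂ : j₁ ≠ j₂) (hj₁₃ : j₁ ≠ j₃) (hj₂₃ : j₂ ≠ j₃)
    (hall : ∀ k, (k = i₁ ∨ k = i₂ ∨ k = i₃) ∨ (k = j₁ ∨ k = j₂ ∨ k = j₃))
    {l : Space3 →L[ℝ] ℝ} {c d : ℝ} (hcd : c ≠ d)
    (hl : l (s i₁) = c ∧ l (s i₂) = c ∧ l (s i₃) = c)
    (hl' : l (s j₁) = d ∧ l (s j₂) = d ∧ l (s j₃) = d) :
    (IsPlane (affineSpan ℝ {s i₁, s i₂, s i₃}) ∧ IsPlane (affineSpan ℝ {s j₁, s j₂, s j₃}) ∧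
      affineSpan ℝ {s i₁, s i₂, s i₃} ∥ affineSpan ℝ {s j₁, s j₂, s j₃}) ∧
    ∃ H₁ H₂ : AffineSubspace ℝ Space3,
      IsPlane H₁ ∧ IsPlane H₂ ∧ H₁ ∥ H₂ ∧ H₁ ≠ H₂ ∧
      (Set.range s ∩ (H₁ : Set Space3)).ncard = 3 ∧ (Set.range s ∩ (H₂ : Set Space3)).ncard = 3 ∧
      DifferencesOnBoundary (Set.range s ∩ (H₁ : Set Space3)) (Set.range s ∩ (H₂ : Set Space3)) := by
  set T : Set Space3 := {s i₁, s i₂, s i₃} with hT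
  set U : Set Space3 := {s j₁, s j₂, s j₃} with hU
  have hlT : ∀ x ∈ T, l x = c := by rintro _ (rfl | rfl | rfl); exacts [hl.1, hl.2.1, hl.2.2]
  have hlU : ∀ x ∈ U, l x = d := by rintro _ (rfl | rfl | rfl); exacts [hl'.1, hl'.2.1, hl'.2.2]
  have hne : l (s i₁) ≠ l (s j₁) := by rwa [hl.1, hl'.1]
  have hvT := vectorSpan_eq_ker hs h hi₁₂ hi₁₃ hi₂₃ (T := T) (by simp [T]) (by simp [T])
    (by simp [T]) hne hlT
  have hvU := vectorSpan_eq_ker hs h hj₁₂ hj₁₃ hj₂₃ (T := U) (by simp [U]) (by simp [U])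
    (by simp [U]) hne hlU
  have hpT : IsPlane (affineSpan ℝ T) := by
    rw [IsPlane, direction_affineSpan, hvT, finrank_ker_of_ne hne]
  have hpU : IsPlane (affineSpan ℝ U) := by
    rw [IsPlane, direction_affineSpan, hvU, finrank_ker_of_ne hne]
  have hpar : affineSpan ℝ T ∥ affineSpan ℝ U :=
    parallel_of_vectorSpan_eq ⟨s i₁, by simp [T]⟩ ⟨s j₁, by simp [U]⟩ (hvT.trans hvU.symm)
  have hsT : Set.range s ∩ (affineSpan ℝ T : Set Space3) = T := by
    refine Set.Subset.antisymm ?_ fun x hx => ⟨?_, subset_affineSpan ℝ T hx⟩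
    · rintro _ ⟨⟨k, rfl⟩, hk⟩
      have hk' := apply_eq_of_mem_affineSpan hlT hk
      rcases hall k with hk'' | hk''
      · rcases hk'' with rfl | rfl | rfl <;> simp [T]
      · exact absurd (hk'.symm.trans (hlU _ (by rcases hk'' with rfl | rfl | rfl <;> simp [U]))) hcd
    · rcases hx with rfl | rfl | rfl <;> exact ⟨_, rfl⟩
  have hsU : Set.range s ∩ (affineSpan ℝ U : Set Space3) = U := by
    refine Set.Subset.antisymm ?_ fun x hx => ⟨?_, subset_affineSpan ℝ U hx⟩
    · rintro _ ⟨⟨k, rfl⟩, hk⟩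
      have hk' := apply_eq_of_mem_affineSpan hlU hk
      rcases hall k with hk'' | hk''
      · exact absurd ((hlT _ (by rcases hk'' with rfl | rfl | rfl <;> simp [T])).symm.trans hk') hcd
      · rcases hk'' with rfl | rfl | rfl <;> simp [U]
    · rcases hx with rfl | rfl | rfl <;> exact ⟨_, rfl⟩
  refine ⟨⟨hpT, hpU, hpar⟩, affineSpan ℝ T, affineSpan ℝ U, hpT, hpU, hpar, fun he => hcd ?_,
    ?_, ?_, h.differencesOnBoundary Set.inter_subset_left Set.inter_subset_left⟩
  · have : s i₁ ∈ affineSpan ℝ U := he ▸ subset_affineSpan ℝ T (by simp [T])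
    exact hl.1.symm.trans (apply_eq_of_mem_affineSpan hlU this)
  · rw [hsT]
    exact Set.ncard_eq_three.2 ⟨_, _, _, hs.ne hi₁₂, hs.ne hi₁₃, hs.ne hi₂₃, rfl⟩
  · rw [hsU]
    exact Set.ncard_eq_three.2 ⟨_, _, _, hs.ne hj₁₂, hs.ne hj₁₃, hs.ne hj₂₃, rfl⟩

/-- A proper face that contains three of the points is a facet. -/
theorem IsSupported.isFacet {s : Fin 6 → Space3} (hs : Function.Injective s)
    (h : IsAntipodal (Set.range s)) {I : Finset (Fin 6)} (hI : IsSupported s I) {i j k m : Fin 6}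
    (hij : i ≠ j) (hik : i ≠ k) (hjk : j ≠ k) (hi : i ∈ I) (hj : j ∈ I) (hk : k ∈ I)
    (hm : m ∉ I) : IsFacet (convexHull ℝ (Set.range s)) (convexHull ℝ (s '' I)) := by
  refine ⟨hI.isFace, ?_⟩
  obtain ⟨l, c, hl⟩ := hI
  have hne : l (s m) ≠ l (s i) := by
    rw [(hl i).2.2 hi]
    exact fun hc => hm ((hl m).2.1 hc)
  rw [vectorSpan_convexHull, vectorSpan_convexHull,
    vectorSpan_eq_ker hs h hij hik hjk (T := s '' I) ⟨i, hi, rfl⟩ ⟨j, hj, rfl⟩ ⟨k, hk, rfl⟩ hne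
      (c := c) (by rintro _ ⟨n, hn, rfl⟩; exact (hl n).2.2 hn),
    finrank_ker_of_ne hne,
    finrank_vectorSpan_range hs h hij hik hjk ((hl i).2.2 hi) ((hl j).2.2 hj) ((hl k).2.2 hk)
      fun hc => hm ((hl m).2.1 hc)]

theorem comp_mem_affineDeps {s : Fin 6 → Space3} {φ : Fin 6 → ℝ} (h : φ ∈ affineDeps s)
    (σ : Equiv.Perm (Fin 6)) : φ ∘ σ ∈ affineDeps (s ∘ σ) := by
  rw [mem_affineDeps] at h ⊢
  exact ⟨(Equiv.sum_comp σ φ).trans h.1, (Equiv.sum_comp σ fun i => φ i • s i).trans h.2⟩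

theorem range_eq_of_fin_six (s : Fin 6 → Space3) :
    Set.range s = {s 0, s 1, s 2, s 3, s 4, s 5} := by
  ext x
  simp [Fin.exists_fin_succ, eq_comm]

/-! ### The three model polytopes -/

def octahedronPoints : Fin 6 → Space3 :=
  ![!₂[1, 0, 0], !₂[-1, 0, 0], !₂[0, 1, 0], !₂[0, -1, 0], !₂[0, 0, 1], !₂[0, 0, -1]]

def prismPoints : Fin 6 → Space3 :=
  ![!₂[0, 0, 0], !₂[1, 0, 0], !₂[1, 1, 0], !₂[0, 1, 0], !₂[0, 0, 1], !₂[1, 0, 1]]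

def skewPrismPoints : Fin 6 → Space3 :=
  ![!₂[0, 0, 0], !₂[1, 0, 0], !₂[1, 1, 0], !₂[0, 1, 0], !₂[0, 0, 1], !₂[1, 1, 1]]

theorem range_octahedronPoints : Set.range octahedronPoints = octahedronVertices :=
  range_eq_of_fin_six _

theorem range_prismPoints : Set.range prismPoints = prismVertices :=
  range_eq_of_fin_six _

theorem range_skewPrismPoints : Set.range skewPrismPoints = skewPrismVertices :=
  range_eq_of_fin_six _

theorem octahedronPoints_injective : Function.Injective octahedronPoints := by
  intro i j hij
  have h0 := congrArg (fun x : Space3 => x 0) hij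
  have h1 := congrArg (fun x : Space3 => x 1) hij
  have h2 := congrArg (fun x : Space3 => x (2 : Fin 3)) hij
  fin_cases i <;> fin_cases j <;>
    first
    | rfl
    | (exfalso; norm_num [octahedronPoints] at h0; done)
    | (exfalso; norm_num [octahedronPoints] at h1; done)
    | (exfalso; norm_num [octahedronPoints, Matrix.cons_val_two] at h2)

theorem prismPoints_injective : Function.Injective prismPoints := by
  intro i j hij
  have h0 := congrArg (fun x : Space3 => x 0) hij
  have h1 := congrArg (fun x : Space3 => x 1) hij
  have h2 := congrArg (fun x : Space3 => x (2 : Fin 3)) hij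
  fin_cases i <;> fin_cases j <;>
    first
    | rfl
    | (exfalso; norm_num [prismPoints] at h0; done)
    | (exfalso; norm_num [prismPoints] at h1; done)
    | (exfalso; norm_num [prismPoints, Matrix.cons_val_two] at h2)

theorem skewPrismPoints_injective : Function.Injective skewPrismPoints := by
  intro i j hij
  have h0 := congrArg (fun x : Space3 => x 0) hij
  have h1 := congrArg (fun x : Space3 => x 1) hij
  have h2 := congrArg (fun x : Space3 => x (2 : Fin 3)) hij
  fin_cases i <;> fin_cases j <;>
    first
    | rfl
    | (exfalso; norm_num [skewPrismPoints] at h0; done)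
    | (exfalso; norm_num [skewPrismPoints] at h1; done)
    | (exfalso; norm_num [skewPrismPoints, Matrix.cons_val_two] at h2)

/-- Sets of vertices of the unit cube are antipodal. -/
theorem isAntipodal_of_zero_or_one {T : Set Space3} (h : ∀ x ∈ T, ∀ i, x i = 0 ∨ x i = 1) :
    IsAntipodal T := by
  intro x hx y hy hxy
  obtain ⟨i, hi⟩ : ∃ i, x i ≠ y i := by
    by_contra! hc
    exact hxy (by ext i; exact hc i)
  have hb : ∀ z ∈ T, 0 ≤ z i ∧ z i ≤ 1 := by
    intro z hz
    rcases h z hz i with h | h <;> simp [h]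
  rcases h x hx i with h0 | h0 <;> rcases h y hy i with h1 | h1
  · exact absurd (h0.trans h1.symm) hi
  · refine ⟨EuclideanSpace.proj i, ?_, fun z hz => ?_⟩
    · simp [h0, h1]
    · simpa [h0, h1] using hb z hz
  · refine ⟨-EuclideanSpace.proj i, ?_, fun z hz => ?_⟩
    · simp [h0, h1]
    · simpa [h0, h1, and_comm] using hb z hz
  · exact absurd (h0.trans h1.symm) hi

theorem isAntipodal_prismPoints : IsAntipodal (Set.range prismPoints) := by
  refine isAntipodal_of_zero_or_one ?_
  rintro _ ⟨k, rfl⟩ i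
  fin_cases k <;> fin_cases i <;> simp [prismPoints]

theorem isAntipodal_skewPrismPoints : IsAntipodal (Set.range skewPrismPoints) := by
  refine isAntipodal_of_zero_or_one ?_
  rintro _ ⟨k, rfl⟩ i
  fin_cases k <;> fin_cases i <;> simp [skewPrismPoints]

/-- The functionals `±x ± y ± z` take only the values `±1` at the vertices, and any two vertices are
separated by one of them. -/
theorem isAntipodal_octahedronPoints : IsAntipodal (Set.range octahedronPoints) := by
  let F : Fin 4 → Space3 →L[ℝ] ℝ := ![
    EuclideanSpace.proj 0 + EuclideanSpace.proj 1 + EuclideanSpace.proj 2,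
    EuclideanSpace.proj 0 + EuclideanSpace.proj 1 - EuclideanSpace.proj 2,
    EuclideanSpace.proj 0 - EuclideanSpace.proj 1 + EuclideanSpace.proj 2,
    EuclideanSpace.proj 0 - EuclideanSpace.proj 1 - EuclideanSpace.proj 2]
  let v : Fin 4 → Fin 6 → ℤ := ![![1, -1, 1, -1, 1, -1], ![1, -1, 1, -1, -1, 1],
    ![1, -1, -1, 1, 1, -1], ![1, -1, -1, 1, -1, 1]]
  have hF : ∀ m k, F m (octahedronPoints k) = v m k := by
    intro m k
    fin_cases m <;> fin_cases k <;> simp [F, v, octahedronPoints]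
  have hv : ∀ m k, -1 ≤ v m k ∧ v m k ≤ 1 := by decide
  have hsep : ∀ i j : Fin 6, i ≠ j → ∃ m, (v m i = -1 ∧ v m j = 1) ∨ (v m i = 1 ∧ v m j = -1) := by
    decide
  have hv' : ∀ m k, (-1 : ℝ) ≤ v m k ∧ (v m k : ℝ) ≤ 1 := fun m k => by
    have := hv m k
    exact ⟨by exact_mod_cast this.1, by exact_mod_cast this.2⟩
  rintro _ ⟨i, rfl⟩ _ ⟨j, rfl⟩ hij
  obtain ⟨m, ⟨h1, h2⟩ | ⟨h1, h2⟩⟩ := hsep i j (fun h => hij (by rw [h]))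
  · refine ⟨F m, ?_, ?_⟩
    · rw [hF, hF, h1, h2]; norm_num
    · rintro _ ⟨k, rfl⟩
      rw [hF, hF, hF, h1, h2]
      simpa using hv' m k
  · refine ⟨-F m, ?_, ?_⟩
    · rw [neg_apply, neg_apply, hF, hF, h1, h2]; norm_num
    · rintro _ ⟨k, rfl⟩
      rw [neg_apply, neg_apply, neg_apply, hF, hF, hF, h1, h2]
      have := hv' m k
      push_cast
      constructor <;> linarith

theorem isSupported_octahedronPoints (I : Finset (Fin 6)) :
    IsSupported octahedronPoints I ↔ IsIntersection octahedronFacets I := by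
  refine isSupported_iff_of_isOctahedralGale octahedronPoints_injective
    isAntipodal_octahedronPoints (p := ![1, 1, 0, 0, -1, -1]) (q := ![0, 0, 1, 1, -1, -1]) ?_ ?_ ?_ I
  · rw [mem_affineDeps]
    refine ⟨by simp [Fin.sum_univ_six], ?_⟩
    ext i
    fin_cases i <;> simp [Fin.sum_univ_six, octahedronPoints]
  · rw [mem_affineDeps]
    refine ⟨by simp [Fin.sum_univ_six], ?_⟩
    ext i
    fin_cases i <;> simp [Fin.sum_univ_six, octahedronPoints]
  · constructor <;> simp [bracket]

theorem isSupported_prismPoints (I : Finset (Fin 6)) :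
    IsSupported prismPoints I ↔ IsIntersection prismFacets I := by
  refine isSupported_iff_of_prism prismPoints_injective isAntipodal_prismPoints ?_ ?_ I
  · rw [mem_affineDeps]
    refine ⟨by simp [Fin.sum_univ_six, parallelogramDep], ?_⟩
    ext i
    fin_cases i <;> simp [Fin.sum_univ_six, prismPoints, parallelogramDep]
  · rw [mem_affineDeps]
    refine ⟨by simp [Fin.sum_univ_six, topEdgeDep], ?_⟩
    ext i
    fin_cases i <;> simp [Fin.sum_univ_six, prismPoints, topEdgeDep]

theorem isSupported_skewPrismPoints (I : Finset (Fin 6)) :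
    IsSupported skewPrismPoints I ↔ IsIntersection skewPrismFacets I := by
  refine isSupported_iff_of_skewPrism skewPrismPoints_injective isAntipodal_skewPrismPoints
    (le_refl 0) one_pos ?_ ?_ I
  · rw [mem_affineDeps]
    refine ⟨by simp [Fin.sum_univ_six, parallelogramDep], ?_⟩
    ext i
    fin_cases i <;> simp [Fin.sum_univ_six, skewPrismPoints, parallelogramDep]
  · rw [mem_affineDeps]
    refine ⟨by simp [Fin.sum_univ_six, topEdgeDep], ?_⟩
    ext i
    fin_cases i <;> simp [Fin.sum_univ_six, skewPrismPoints, topEdgeDep]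

theorem natCard_eq_of_isSupported_iff {s : Fin 6 → Space3} {K : Finset (Finset (Fin 6))}
    (h : ∀ I, IsSupported s I ↔ IsIntersection K I) :
    Nat.card {I // IsSupported s I} = Fintype.card {I // IsIntersection K I} := by
  rw [← Nat.card_eq_fintype_card]
  exact Nat.card_congr (Equiv.subtypeEquivRight h)

/-! ### Assembling the classification -/

/-- The statement about planes in the classification of antipodal sets of six points. -/
def HasParallelPlanes (S : Set Space3) : Prop :=
  ∃ H₁ H₂ : AffineSubspace ℝ Space3,
    IsPlane H₁ ∧ IsPlane H₂ ∧ H₁ ∥ H₂ ∧ H₁ ≠ H₂ ∧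
    (S ∩ (H₁ : Set Space3)).ncard = 3 ∧ (S ∩ (H₂ : Set Space3)).ncard = 3 ∧
    DifferencesOnBoundary (S ∩ (H₁ : Set Space3)) (S ∩ (H₂ : Set Space3))

theorem isOctahedralType_of_isOctahedralGale {s : Fin 6 → Space3} (hs : Function.Injective s)
    (h : IsAntipodal (Set.range s)) {p q : Fin 6 → ℝ} (hp : p ∈ affineDeps s)
    (hq : q ∈ affineDeps s) (ho : IsOctahedralGale p q) :
    HasParallelPlanes (Set.range s) ∧ IsOctahedralType (Set.range s) := by
  have hp' := (mem_affineDeps.1 hp).1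
  have hq' := (mem_affineDeps.1 hq).1
  rw [Fin.sum_univ_six] at hp' hq'
  -- As the Gale vectors `0, 2, 4` sum to zero, the indicator of this triple is orthogonal to all
  -- dependences; its affine function defines the parallel planes.
  obtain ⟨l, c, hl⟩ := exists_affine_of_orthogonal hs h hp hq ho.h02.ne' (v := ![1, 0, 1, 0, 1, 0])
    (by simp [Fin.sum_univ_six]; exact ho.sum_p) (by simp [Fin.sum_univ_six]; exact ho.sum_q)
  have l0 : 1 = l (s 0) + c := hl 0
  have l1 : 0 = l (s 1) + c := hl 1
  have l2 : 1 = l (s 2) + c := hl 2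
  have l3 : 0 = l (s 3) + c := hl 3
  have l4 : 1 = l (s 4) + c := hl 4
  have l5 : 0 = l (s 5) + c := hl 5
  have hcd : 1 - c ≠ -c := by intro h; linarith
  have e0 : l (s 0) = 1 - c ∧ l (s 2) = 1 - c ∧ l (s 4) = 1 - c :=
    ⟨by linarith, by linarith, by linarith⟩
  have e1 : l (s 1) = -c ∧ l (s 3) = -c ∧ l (s 5) = -c :=
    ⟨by linarith, by linarith, by linarith⟩
  obtain ⟨⟨-, -, hpar⟩, hplanes⟩ := exists_parallel_planes hs h (i₁ := 0) (i₂ := 2) (i₃ := 4)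
    (j₁ := 1) (j₂ := 3) (j₃ := 5) (by decide) (by decide) (by decide) (by decide) (by decide)
    (by decide) (by decide) hcd e0 e1
  have hface := isSupported_iff_of_isOctahedralGale hs h hp hq ho
  have him : s '' (({0, 2, 4} : Finset (Fin 6)) : Set (Fin 6)) = {s 0, s 2, s 4} := by
    simp [Set.image_insert_eq]
  have him' : s '' (({1, 3, 5} : Finset (Fin 6)) : Set (Fin 6)) = {s 1, s 3, s 5} := by
    simp [Set.image_insert_eq]
  have hF := ((hface {0, 2, 4}).2 (by decide)).isFacet hs h (i := 0) (j := 2) (k := 4) (m := 1)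
    (by decide) (by decide) (by decide) (by decide) (by decide) (by decide) (by decide)
  have hG := ((hface {1, 3, 5}).2 (by decide)).isFacet hs h (i := 1) (j := 3) (k := 5) (m := 0)
    (by decide) (by decide) (by decide) (by decide) (by decide) (by decide) (by decide)
  rw [him] at hF
  rw [him'] at hG
  refine ⟨hplanes, ?_, _, _, hF, hG, ?_, ?_⟩
  · rw [← range_octahedronPoints]
    exact combinatoriallyEquivalent_of_isSupported_iff fun I =>
      (hface I).trans (isSupported_octahedronPoints I).symm
  · rw [Set.disjoint_left]
    intro x hx hx'
    refine hcd ((eq_of_mem_convexHull (l := l) ?_ hx).symm.trans (eq_of_mem_convexHull ?_ hx'))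
    · rintro _ (rfl | rfl | rfl)
      exacts [e0.1, e0.2.1, e0.2.2]
    · rintro _ (rfl | rfl | rfl)
      exacts [e1.1, e1.2.1, e1.2.2]
  · rwa [affineSpan_convexHull, affineSpan_convexHull]

theorem isSkewPrismType_of_mem_affineDeps {s : Fin 6 → Space3} (hs : Function.Injective s)
    (h : IsAntipodal (Set.range s)) {α : ℝ} (hα0 : 0 ≤ α) (hα1 : α ≤ 1)
    (hp : parallelogramDep ∈ affineDeps s) (hq : topEdgeDep α ∈ affineDeps s) :
    HasParallelPlanes (Set.range s) ∧ IsSkewPrismType (Set.range s) := by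
  obtain ⟨l, c, hl⟩ := exists_affine_of_orthogonal hs h hp hq (bracket_prism_ne_zero α)
    (v := ![1, 0, 0, 1, 1, 0]) (by simp [Fin.sum_univ_six, parallelogramDep])
    (by simp [Fin.sum_univ_six, topEdgeDep])
  have l0 : 1 = l (s 0) + c := hl 0
  have l1 : 0 = l (s 1) + c := hl 1
  have l2 : 0 = l (s 2) + c := hl 2
  have l3 : 1 = l (s 3) + c := hl 3
  have l4 : 1 = l (s 4) + c := hl 4
  have l5 : 0 = l (s 5) + c := hl 5
  have hcd : 1 - c ≠ -c := by intro h; linarith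
  have e0 : l (s 0) = 1 - c ∧ l (s 3) = 1 - c ∧ l (s 4) = 1 - c :=
    ⟨by linarith, by linarith, by linarith⟩
  have e1 : l (s 1) = -c ∧ l (s 2) = -c ∧ l (s 5) = -c :=
    ⟨by linarith, by linarith, by linarith⟩
  obtain ⟨⟨hpl₁, hpl₂, hpar⟩, hplanes⟩ := exists_parallel_planes hs h (i₁ := 0) (i₂ := 3) (i₃ := 4)
    (j₁ := 1) (j₂ := 2) (j₃ := 5) (by decide) (by decide) (by decide) (by decide) (by decide)
    (by decide) (by decide) hcd e0 e1
  have hdep := (mem_affineDeps.1 hp).2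
  have hdep' := (mem_affineDeps.1 hq).2
  simp only [Fin.sum_univ_six, parallelogramDep, topEdgeDep, Matrix.cons_val_zero,
    Matrix.cons_val_one, Matrix.cons_val] at hdep hdep'
  have hpar₁ : s 1 - s 0 = s 2 - s 3 := by
    rw [← sub_eq_zero, ← neg_eq_zero, ← hdep]; module
  have htop : s 5 - s 4 = s 2 - ((1 - α) • s 0 + α • s 3) := by
    rw [← sub_eq_zero, ← hdep']; module
  have hparallel : line[ℝ, s 4, s 5] ∥ line[ℝ, s 0, s 1] ↔ α = 1 := by
    rw [AffineSubspace.affineSpan_pair_parallel_iff_vectorSpan_eq]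
    constructor
    · intro hv
      have hmem := vsub_rev_mem_vectorSpan_pair ℝ (s 4) (s 5)
      rw [hv, mem_vectorSpan_pair_rev] at hmem
      obtain ⟨r, hr⟩ := hmem
      simp only [vsub_eq_sub] at hr
      -- Parallelism is itself a dependence. Writing it in the basis and comparing the entries at
      -- `2`, `3` and `5` gives `α = 1`.
      have hφ : (![r, -r, 0, 0, -1, 1] : Fin 6 → ℝ) ∈ affineDeps s := by
        rw [mem_affineDeps]
        refine ⟨by simp [Fin.sum_univ_six], ?_⟩
        simp only [Fin.sum_univ_six, Matrix.cons_val_zero, Matrix.cons_val_one, Matrix.cons_val]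
        rw [← sub_eq_zero.2 hr.symm]; module
      obtain ⟨x, y, hxy⟩ :=
        exists_combination_of_mem_affineDeps hs h hp hq (bracket_prism_ne_zero α) hφ
      have x2 := hxy 2
      have x3 := hxy 3
      have x5 := hxy 5
      simp [parallelogramDep, topEdgeDep] at x2 x3 x5
      rw [← x5] at x2 x3
      linarith
    · rintro rfl
      rw [vectorSpan_pair_rev, vectorSpan_pair_rev, vsub_eq_sub, vsub_eq_sub, htop, hpar₁]
      simp
  have hcomb : (α = 1 → ∀ I, IsSupported s I ↔ IsIntersection prismFacets I) ∧
      (α ≠ 1 → ∀ I, IsSupported s I ↔ IsIntersection skewPrismFacets I) := by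
    refine ⟨?_, fun hα => isSupported_iff_of_skewPrism hs h hα0 (lt_of_le_of_ne hα1 hα) hp hq⟩
    rintro rfl
    exact isSupported_iff_of_prism hs h hp hq
  have hbase : IsSupported s {0, 1, 2, 3} := by
    by_cases hα : α = 1
    · exact (hcomb.1 hα _).2 (by decide)
    · exact (hcomb.2 hα _).2 (by decide)
  have hedge : IsSupported s {4, 5} := by
    by_cases hα : α = 1
    · exact (hcomb.1 hα _).2 (by decide)
    · exact (hcomb.2 hα _).2 (by decide)
  refine ⟨hplanes, s 0, s 1, s 2, s 3, s 4, s 5, range_eq_of_fin_six s,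
    ⟨hpar₁, affineIndependent_of_antipodal hs h (by decide) (by decide) (by decide)⟩, ?_, ?_, ?_,
    hpl₁, hpl₂, hpar, fun hline => ?_, fun hline => ?_⟩
  · have := hbase.isFacet hs h (i := 0) (j := 1) (k := 2) (m := 4)
      (by decide) (by decide) (by decide) (by decide) (by decide) (by decide) (by decide)
    rwa [show s '' (({0, 1, 2, 3} : Finset (Fin 6)) : Set (Fin 6)) = {s 0, s 1, s 2, s 3} by
      simp [Set.image_insert_eq]] at this
  · have := hedge.isFace
    rw [show s '' (({4, 5} : Finset (Fin 6)) : Set (Fin 6)) = {s 4, s 5} by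
      simp [Set.image_insert_eq], convexHull_pair] at this
    refine ⟨this, ?_⟩
    rw [vectorSpan_segment, finrank_span_singleton]
    exact sub_ne_zero.2 (hs.ne (by decide))
  -- The dependence reads `f - e = c - e'` with `e' = (1 - α) a + α d`, so `f'` is the endpoint `c`.
  · refine ⟨(1 - α) • s 0 + α • s 3, ⟨1 - α, α, by linarith, hα0, by ring, rfl⟩, s 2,
      right_mem_segment ℝ _ _, s 4 - ((1 - α) • s 0 + α • s 3), by simp, ?_⟩
    rw [sub_eq_iff_eq_add] at htop
    rw [htop]; abel
  · rw [← range_prismPoints]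
    exact combinatoriallyEquivalent_of_isSupported_iff fun I =>
      (hcomb.1 (hparallel.1 hline) I).trans (isSupported_prismPoints I).symm
  · rw [← range_skewPrismPoints]
    exact combinatoriallyEquivalent_of_isSupported_iff fun I =>
      (hcomb.2 (fun hα => hline (hparallel.2 hα)) I).trans (isSupported_skewPrismPoints I).symm

/-- The classification of antipodal sets of six points in three-dimensional space. -/
theorem IsAntipodal.classification {s : Fin 6 → Space3} (hs : Function.Injective s)
    (h : IsAntipodal (Set.range s)) : HasParallelPlanes (Set.range s) ∧
      (IsOctahedralType (Set.range s) ∨ IsSkewPrismType (Set.range s)) := by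
  obtain ⟨p, hp, q, hq, hg, hp0⟩ := exists_isGale
    (fun φ hφ => antipodalVector_of_mem_affineDeps hs h hφ) (finrank_affineDeps hs h)
  obtain ⟨σ, hσ⟩ := hg.isClassified hp0
  have hr : Set.range (s ∘ σ) = Set.range s := σ.surjective.range_comp s
  have hs' : Function.Injective (s ∘ σ) := hs.comp σ.injective
  have hpσ := comp_mem_affineDeps hp σ
  have hqσ := comp_mem_affineDeps hq σ
  rw [← hr] at h ⊢
  rcases hσ with ho | ⟨α, hα0, hα1, ⟨x, y, hxy⟩, x', y', hxy'⟩
  · have := isOctahedralType_of_isOctahedralGale hs' h hpσ hqσ ho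
    exact ⟨this.1, Or.inl this.2⟩
  · have hmem : ∀ {φ : Fin 6 → ℝ} {x y : ℝ}, (∀ k, φ k = x * (p ∘ σ) k + y * (q ∘ σ) k) →
        φ ∈ affineDeps (s ∘ σ) := by
      intro φ x y hφ
      have := (affineDeps (s ∘ σ)).add_mem ((affineDeps (s ∘ σ)).smul_mem x hpσ)
        ((affineDeps (s ∘ σ)).smul_mem y hqσ)
      rwa [show φ = x • (p ∘ σ) + y • (q ∘ σ) from funext hφ]
    have := isSkewPrismType_of_mem_affineDeps hs' h hα0 hα1 (hmem hxy) (hmem hxy')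
    exact ⟨this.1, Or.inr this.2⟩

theorem mainTheorem5 :
    (∀ S : Set Space3, S.ncard = 6 → IsAntipodal S →
      (∃ H₁ H₂ : AffineSubspace ℝ Space3,
        IsPlane H₁ ∧ IsPlane H₂ ∧ H₁ ∥ H₂ ∧ H₁ ≠ H₂ ∧
        (S ∩ (H₁ : Set Space3)).ncard = 3 ∧ (S ∩ (H₂ : Set Space3)).ncard = 3 ∧
        DifferencesOnBoundary (S ∩ (H₁ : Set Space3)) (S ∩ (H₂ : Set Space3))) ∧
      (IsOctahedralType S ∨ IsSkewPrismType S)) ∧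
    (∀ T ∈ ({octahedronVertices, prismVertices, skewPrismVertices} : Set (Set Space3)),
      T.ncard = 6 ∧ IsAntipodal T) ∧
    ¬ CombinatoriallyEquivalent (convexHull ℝ octahedronVertices) (convexHull ℝ prismVertices) ∧
    ¬ CombinatoriallyEquivalent (convexHull ℝ octahedronVertices)
        (convexHull ℝ skewPrismVertices) ∧
    ¬ CombinatoriallyEquivalent (convexHull ℝ prismVertices) (convexHull ℝ skewPrismVertices) := by
  have hncard : ∀ {s : Fin 6 → Space3}, Function.Injective s → (Set.range s).ncard = 6 := by
    intro s hs
    rw [← Set.image_univ, Set.ncard_image_of_injective _ hs, Set.ncard_univ]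
    simp
  have c₁ := (natCard_eq_of_isSupported_iff isSupported_octahedronPoints).trans
    card_octahedronFacets_faces
  have c₂ := (natCard_eq_of_isSupported_iff isSupported_prismPoints).trans card_prismFacets_faces
  have c₃ := (natCard_eq_of_isSupported_iff isSupported_skewPrismPoints).trans
    card_skewPrismFacets_faces
  refine ⟨fun S hS h => ?_, ?_, ?_, ?_, ?_⟩
  · have hfin : S.Finite := Set.finite_of_ncard_ne_zero (by omega)
    have : Finite S := hfin
    have hcard : Nat.card S = 6 := hS
    let e : Fin 6 ≃ S := (finCongr hcard.symm).trans (Finite.equivFin S).symm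
    have hr : Set.range (fun i => (e i : Space3)) = S := by
      rw [show (fun i => (e i : Space3)) = Subtype.val ∘ e from rfl, e.surjective.range_comp]
      exact Subtype.range_coe
    rw [← hr] at h ⊢
    exact h.classification (Subtype.val_injective.comp e.injective)
  · rintro T (rfl | rfl | rfl)
    · rw [← range_octahedronPoints]
      exact ⟨hncard octahedronPoints_injective, isAntipodal_octahedronPoints⟩
    · rw [← range_prismPoints]
      exact ⟨hncard prismPoints_injective, isAntipodal_prismPoints⟩
    · rw [← range_skewPrismPoints]
      exact ⟨hncard skewPrismPoints_injective, isAntipodal_skewPrismPoints⟩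
  · rw [← range_octahedronPoints, ← range_prismPoints]
    intro h
    have := h.natCard_eq
    omega
  · rw [← range_octahedronPoints, ← range_skewPrismPoints]
    intro h
    have := h.natCard_eq
    omega
  · rw [← range_prismPoints, ← range_skewPrismPoints]
    intro h
    have := h.natCard_eq
    omega
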